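/- Let $K$ be a field of characteristic $0$ and $\mathcal{C}_K=K[\hbar,\hbar^{-1}]$. Let $\widehat{\mathfrak{H}^1}$ be the non-commutative polynomial ring over $\mathcal{C}_K$ in the variables $e_1$ and $g_k$ ($k\ge1$); it is freely generated by $\mathcal{A}=\{e_1-g_1\}\sqcup\{g_k\mid k\ge 1\}$. Let $\mathfrak{z}$ be the free $\mathcal{C}_K$-module spanned by $\mathcal{A}$, let $\widehat{\mathfrak{H}^0}$ be the $\mathcal{C}_K$-submodule of $\widehat{\mathfrak{H}^1}$ spanned by $1$ and the words $u_1\cdots u_r$ ($r\ge 1$, $u_a\in\mathcal{A}$) with $u_r\neq e_1-g_1$, and set $e_k=g_k+\hbar g_{k-1}$ for $k\ge2$. Let $\circ_\hbar$ be the symmetric $\mathcal{C}_K$-bilinear product on $\mathfrak{z}$ with $(e_1-g_1)\circ_\hbar(e_1-g_1)=\hbar(e_1-g_1)$, $(e_1-g_1)\circ_\hbar g_k=\hbar g_k$, $g_k\circ_\hbar g_l=g_{k+l}$, and write $u^{\circ_\hbar L}$ for the $L$-th power of $u\in\mathfrak z$. Let $\ast_\hbar$ be the $\mathcal{C}_K$-bilinear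 product on $\widehat{\mathfrak{H}^1}$ with unit $1$ and $(wu)\ast_\hbar(w'v)=(w\ast_\hbar w'v)u+(wu\ast_\hbar w')v+(w\ast_\hbar w')(u\circ_\hbar v)$ for $w,w'\in\widehat{\mathfrak{H}^1}$, $u,v\in\mathcal{A}$, extended coefficientwise to $\widehat{\mathfrak{H}^1}[[X]]$, and for $f\in X\widehat{\mathfrak{H}^1}[[X]]$ let $\exp_{\ast_\hbar}(f)=1+\sum_{n\ge1}\frac1{n!}f^{\ast_\hbar n}$. Let $\phi_k=\sum_{j=1}^{k}(j-1)!\,{k\brace j}\,\hbar^{k-j}g_j$ for $k\ge 1$, with Stirling numbers of the second kind, and let $\arcsin$ denote the formal power series $\sum_{j\ge0}\binom{2j}{j}\frac{x^{2j+1}}{4^j(2j+1)}$. The notation $1/D$ means the inverse of $D$ for the concatenation product of $\widehat{\mathfrak{H}^1}[[X]]$. (1) Let $K=\mathbb{C}$. For every $L\ge1$ the series $1+(-1)^L\hbar^{-2L}e_2^{\circ_\hbar L}X^{2L}$ is invertible, its inverse has coefficients in $\widehat{\mathfrak{H}^0}$, and $$\frac{1}{1+(-1)^{L}\hbar^{-2L}e_2^{\circ_\hbar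 L}X^{2L}}=\exp_{\ast_\hbar}\left(2\sum_{k\ge1}\frac{(-1)^{k-1}}{(2k)!}\hbar^{-2k}\phi_{2k}\sum_{m=1}^{L}\left(2\arcsin\frac{e^{m\pi i/L}X}{2}\right)^{2k}\right).$$ (2) In particular (algebraic form of Bachmann's identity), for $K=\mathbb{Q}$ the series $1-\hbar^{-2}e_2X^2$ is invertible, its inverse has coefficients in $\widehat{\mathfrak{H}^0}$, and $$\frac{1}{1-\hbar^{-2}e_2X^2}=\exp_{\ast_\hbar}\left(2\sum_{k\ge1}\frac{(-1)^{k-1}}{(2k)!}\hbar^{-2k}\phi_{2k}\,(2\arcsin(X/2))^{2k}\right).$$ (3) Consequently (Bachmann's formula), for every real $q$ with $0<q<1$ the series $A_r(q)=\sum_{0<m_1<\cdots<m_r}\prod_{a=1}^r\frac{q^{m_a}}{(1-q^{m_a})^2}$ ($r\ge1$) and $G_{2k}(q)=\sum_{n\ge1}\sigma_{2k-1}(n)q^n$ ($k\ge1$), where $\sigma_a(n)=\sum_{d\mid n}d^a$, converge, and in $\mathbb{R}[[X]]$ $$1+\sum_{r\ge1}A_r(q)X^{2r}=\exp\left(2\sum_{k\ge1}\frac{(-1)^{k-1}}{(2k)!}G_{2k}(q)\,(2\arcsin(X/2))^{2k}\right).$$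 -/

import Mathlib

noncomputable section

namespace HarmonicAlgebra

open PowerSeries

/-- The Laurent polynomial ring `𝒞 = K[ħ, ħ⁻¹]`; the monomial `ħ ^ n` (`n : ℤ`) is `ħ K n`. -/
abbrev Coeff (K : Type*) [Field K] : Type _ := LaurentPolynomial K

/-- The integer powers of the formal variable `ħ`. -/
abbrev ħ (K : Type*) [Field K] (n : ℤ) : Coeff K := LaurentPolynomial.T n

/-- The alphabet `𝒜 = {e₁ - g₁} ⊔ {g_k | k ≥ 1}`; the letter `a` stands for `e₁ - g₁`. -/
inductive Letter : Type
  | a : Letter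
  | g (k : ℕ+) : Letter

/-- The non-commutative polynomial ring over `𝒞` in the variables `e₁, g₁, g₂, …`, presented by its
free generating set `𝒜` (so that `e₁ = a + g₁`). Its multiplication is concatenation. -/
abbrev H1 (K : Type*) [Field K] : Type _ := FreeAlgebra (Coeff K) Letter

/-- The free `𝒞`-module `𝔷` spanned by the alphabet. -/
abbrev Z (K : Type*) [Field K] : Type _ := Letter →₀ Coeff K

section

variable (K : Type*) [Field K]

/-- The inclusion `𝔷 ⊆ H1`. -/
def toH1 : Z K →ₗ[Coeff K] H1 K :=
  Finsupp.linearCombination (Coeff K) (FreeAlgebra.ι (Coeff K))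

/-- The word `u₁ ⋯ u_r`. -/
def word (l : List Letter) : H1 K := (l.map (FreeAlgebra.ι (Coeff K))).prod

/-- The submodule `H0` of `H1` spanned by `1` and the words whose last letter is not `e₁ - g₁`. -/
def H0 : Submodule (Coeff K) (H1 K) :=
  Submodule.span (Coeff K)
    ({1} ∪ {x | ∃ (l : List Letter) (k : ℕ+), x = word K (l ++ [Letter.g k])})

/-- The element `g_k` of `𝔷`. -/
def g (k : ℕ+) : Z K := Finsupp.single (Letter.g k) 1

/-- The elements `e₁` and `e_k = g_k + ħ g_{k-1}` (`k ≥ 2`) of `𝔷`; the index `0` is not used. -/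
def e : ℕ → Z K
  | 0 => 0
  | 1 => Finsupp.single Letter.a 1 + g K 1
  | k + 2 => g K (k + 1).succPNat + ħ K 1 • g K k.succPNat

/-- `φ_k = ∑_{j=1}^{k} (j-1)! {k brace j} ħ^{k-j} g_j` with Stirling numbers of the second kind;
the summation index is `i = j - 1`. -/
def phi (k : ℕ) : Z K :=
  ∑ i ∈ Finset.range k,
    (((i.factorial * Nat.stirlingSecond k (i + 1) : ℕ) : Coeff K) * ħ K ((k : ℤ) - (i + 1))) •
      g K i.succPNat

/-- The product `∘_ħ` of two letters. -/
def letterCirc : Letter → Letter → Z K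
  | .a, .a => Finsupp.single .a (ħ K 1)
  | .a, .g k => Finsupp.single (.g k) (ħ K 1)
  | .g k, .a => Finsupp.single (.g k) (ħ K 1)
  | .g k, .g l => Finsupp.single (.g (k + l)) 1

/-- The `𝒞`-bilinear product `∘_ħ` on `𝔷`. -/
def circ : Z K →ₗ[Coeff K] Z K →ₗ[Coeff K] Z K :=
  Finsupp.linearCombination (Coeff K) fun u =>
    Finsupp.linearCombination (Coeff K) fun v => letterCirc K u v

/-- The powers `u^{∘ n}` for `n ≥ 1`; the value at `n = 0` is not used. -/
def circPow (u : Z K) : ℕ → Z K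
  | 0 => 0
  | 1 => u
  | n + 2 => circ K (circPow u (n + 1)) u

/-- The harmonic product of two words, each given by its list of letters read from right to left:
`(w u) * (w' v) = (w * w' v) u + (w u * w') v + (w * w') (u ∘ v)`. -/
def harmWord : List Letter → List Letter → H1 K
  | [], w' => word K w'.reverse
  | u :: w, [] => word K (u :: w).reverse
  | u :: w, v :: w' =>
      harmWord w (v :: w') * FreeAlgebra.ι (Coeff K) u
        + harmWord (u :: w) w' * FreeAlgebra.ι (Coeff K) v
        + harmWord w w' * toH1 K (letterCirc K u v)
  termination_by w w' => w.length + w'.length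

/-- The harmonic product `*_ħ` on `H1`, the `𝒞`-bilinear extension of the product of words. -/
def harm : H1 K →ₗ[Coeff K] H1 K →ₗ[Coeff K] H1 K :=
  (FreeAlgebra.basisFreeMonoid (Coeff K) Letter).constr (Coeff K) fun w =>
    (FreeAlgebra.basisFreeMonoid (Coeff K) Letter).constr (Coeff K) fun w' =>
      harmWord K w.toList.reverse w'.toList.reverse

theorem basis_eq_word (w : FreeMonoid Letter) :
    FreeAlgebra.basisFreeMonoid (Coeff K) Letter w = word K w.toList := by
  simp [FreeAlgebra.basisFreeMonoid, FreeAlgebra.equivMonoidAlgebraFreeMonoid, word,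
    FreeMonoid.lift_apply]

theorem harm_word (l l' : List Letter) :
    harm K (word K l) (word K l') = harmWord K l.reverse l'.reverse := by
  have h1 := basis_eq_word K (FreeMonoid.ofList l)
  have h2 := basis_eq_word K (FreeMonoid.ofList l')
  simp only [FreeMonoid.toList_ofList] at h1 h2
  rw [← h1, ← h2, harm, Module.Basis.constr_basis, Module.Basis.constr_basis]
  simp

/-- Two linear maps out of `H1` that agree on words are equal. -/
theorem linearMap_ext_word {M : Type*} [AddCommMonoid M] [Module (Coeff K) M]
    {f f' : H1 K →ₗ[Coeff K] M} (h : ∀ l, f (word K l) = f' (word K l)) : f = f' :=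
  (FreeAlgebra.basisFreeMonoid (Coeff K) Letter).ext fun w => by
    rw [basis_eq_word]; exact h _

theorem one_harm (w : H1 K) : harm K 1 w = w := by
  have : harm K 1 = LinearMap.id := linearMap_ext_word K fun l => by
    have := harm_word K [] l
    simpa [word, harmWord] using this
  rw [this]; rfl

theorem harm_one (w : H1 K) : harm K w 1 = w := by
  have : (harm K).flip 1 = LinearMap.id := linearMap_ext_word K fun l => by
    have := harm_word K l []
    cases h : l.reverse with
    | nil => simp_all [word, harmWord]
    | cons u t =>
      have h' : l = t.reverse ++ [u] := by
        rw [← List.reverse_reverse l, h]; simp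
      subst h'
      simpa [word, harmWord] using this
  exact congrArg (fun f => f w) this

/-- The recursion that, together with `1` being a unit, characterizes the harmonic product. -/
theorem harm_mul_letter (w w' : H1 K) (u v : Letter) :
    harm K (w * FreeAlgebra.ι (Coeff K) u) (w' * FreeAlgebra.ι (Coeff K) v) =
      harm K w (w' * FreeAlgebra.ι (Coeff K) v) * FreeAlgebra.ι (Coeff K) u
        + harm K (w * FreeAlgebra.ι (Coeff K) u) w' * FreeAlgebra.ι (Coeff K) v
        + harm K w w' * toH1 K (circ K (Finsupp.single u 1) (Finsupp.single v 1)) := by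
  let U := LinearMap.mulRight (Coeff K) (FreeAlgebra.ι (Coeff K) u)
  let V := LinearMap.mulRight (Coeff K) (FreeAlgebra.ι (Coeff K) v)
  let W := LinearMap.mulRight (Coeff K)
    (toH1 K (circ K (Finsupp.single u 1) (Finsupp.single v 1)))
  have key : (harm K).compl₁₂ U V =
      ((harm K).compl₂ V).compr₂ U + ((harm K) ∘ₗ U).compr₂ V + (harm K).compr₂ W := by
    refine linearMap_ext_word K fun l => linearMap_ext_word K fun l' => ?_
    have hu (l : List Letter) (u : Letter) :
        word K l * FreeAlgebra.ι (Coeff K) u = word K (l ++ [u]) := by simp [word]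
    simp only [LinearMap.compl₁₂_apply, LinearMap.add_apply, LinearMap.compr₂_apply,
      LinearMap.compl₂_apply, LinearMap.comp_apply, U, V, W, LinearMap.mulRight_apply, hu,
      harm_word, List.reverse_append, List.reverse_singleton, List.singleton_append]
    rw [harmWord]
    simp [circ]
  exact congrArg (fun f => f w w') key

end

/-- The sum `∑_{k ≥ 1} F k` of formal power series, for families in which `X ^ k` divides `F k`
(so that only the terms with `k ≤ n` contribute to the coefficient of `X ^ n`). -/
def formalSum {R : Type*} [Semiring R] (F : ℕ → R⟦X⟧) : R⟦X⟧ :=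
  PowerSeries.mk fun n => ∑ k ∈ Finset.Icc 1 n, coeff n (F k)

section

variable {K : Type*} [Field K]

/-- The harmonic product on `H1⟦X⟧`. -/
def harmSeries (f f' : (H1 K)⟦X⟧) : (H1 K)⟦X⟧ :=
  PowerSeries.mk fun n => ∑ p ∈ Finset.HasAntidiagonal.antidiagonal n, harm K (coeff p.1 f) (coeff p.2 f')

/-- The powers of a power series for the harmonic product. -/
def harmPow (f : (H1 K)⟦X⟧) : ℕ → (H1 K)⟦X⟧
  | 0 => 1
  | n + 1 => harmSeries (harmPow f n) f

/-- The exponential `1 + ∑_{n ≥ 1} f^{* n} / n!` for the harmonic product, for a power series `f`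
without constant term. -/
def expHarm (f : (H1 K)⟦X⟧) : (H1 K)⟦X⟧ :=
  1 + formalSum fun n =>
    C (algebraMap (Coeff K) (H1 K) (LaurentPolynomial.C (n.factorial : K)⁻¹)) * harmPow f n

/-- The product `w s(X)` of a scalar power series `s` and a constant `w`. -/
def scalarSeries (s : K⟦X⟧) (w : H1 K) : (H1 K)⟦X⟧ :=
  PowerSeries.mk fun n => (LaurentPolynomial.C (coeff n s) : Coeff K) • w

/-- The Taylor series `arcsin X = ∑_{j ≥ 0} binom(2j, j) / (4 ^ j (2 j + 1)) X ^ (2 j + 1)`. -/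
def arcsinSeries (K : Type*) [Field K] : K⟦X⟧ :=
  PowerSeries.mk fun n =>
    if Odd n then (Nat.centralBinom (n / 2) : K) / (4 ^ (n / 2) * n) else 0

/-- The power series `2 arcsin(c X / 2)`. -/
def twoArcsinHalf (c : K) : K⟦X⟧ := 2 * PowerSeries.rescale (c / 2) (arcsinSeries K)

end

/-- MacMahon's series
`A_r(q) = ∑_{0 < m₁ < ⋯ < m_r} ∏_a q ^ {m_a} / (1 - q ^ {m_a}) ^ 2`: its general term. -/
def macMahonTerm (q : ℝ) (r : ℕ) (m : {m : Fin r → ℕ // StrictMono m ∧ ∀ a, 0 < m a}) : ℝ :=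
  ∏ a, q ^ m.1 a / (1 - q ^ m.1 a) ^ 2

/-- MacMahon's series `A_r(q)`. -/
def macMahonA (q : ℝ) (r : ℕ) : ℝ := ∑' m, macMahonTerm q r m

/-- The general term, indexed by `n - 1`, of `G_k(q) = ∑_{n ≥ 1} σ_{k-1}(n) q ^ n` (`k ≥ 1`). -/
def eisensteinTerm (q : ℝ) (k n : ℕ) : ℝ :=
  (ArithmeticFunction.sigma (k - 1) (n + 1) : ℝ) * q ^ (n + 1)

/-- The series `G_k(q)`, `k ≥ 1`. -/
def eisensteinG (q : ℝ) (k : ℕ) : ℝ := ∑' n, eisensteinTerm q k n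

end HarmonicAlgebra

end

noncomputable section

namespace HarmonicAlgebra

open PowerSeries

/-! Write B_k(s) for `stirlingSum s k`. The recurrence of the Stirling numbers gives ∑ B_k(s) x^k /
k! = -log(1 - s(e^x - 1)). Let θ = 2 arcsin(X/2). Then e^{iθ} + e^{-iθ} = 2 - X², so the product of
1 + s - s e^{iθ} and 1 + s - s e^{-iθ} is 1 + (s + s²)X². Taking logarithms, where the odd powers of
θ cancel, yields log(1 + (s + s²)X²) = 2 ∑ (-1)^{k-1}/(2k)! B_{2k}(s) θ^{2k}. All three claims rest
on this identity, in the form `sum_coeff_twoArcsinHalf_mul_stirlingSum`.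

Algebraic claims: the substitution s^j ↦ ħ^{-j} g_j (`ofPoly`) turns multiplication of polynomials
without constant term into ∘, sends s + s² to ħ^{-2} e₂ and B_k(s) to ħ^{-k} φ_k. The bridge to the
harmonic product is 1/(1 - vX^N) = exp_*(log_∘(1 + vX^N)) (`geomSeries_eq_expHarm`), a consequence
of the Newton-type identity `sum_harm_pow_circPow`. For general L one adds the logarithms with X
replaced by c_m X, where the c_m² run through the L-th roots of unity: ∏ (1 + u c_m² X²) = 1 -
(-u)^L X^{2L}.

Bachmann's formula comes from the same logarithm identity evaluated at real numbers, not from the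
algebraic claims. For s = q^n/(1 - q^n) one has s + s² = q^n/(1 - q^n)². The product of the 1 + (s +
s²)X² over n generates the A_r(q), while the sum of B_k(s) over n is G_k(q). -/

/-! ### Stirling sums and their exponential generating series. -/

/-- The polynomial expression `∑_{j = 1}^{k} (j - 1)! {k brace j} s ^ j`. -/
def stirlingSum {R : Type*} [Semiring R] (s : R) (k : ℕ) : R :=
  ∑ i ∈ Finset.range k, ((i.factorial * Nat.stirlingSecond k (i + 1) : ℕ) : R) * s ^ (i + 1)

theorem map_stirlingSum {R S : Type*} [Semiring R] [Semiring S] (f : R →+* S) (s : R) (k : ℕ) :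
    f (stirlingSum s k) = stirlingSum (f s) k := by
  simp [stirlingSum]

theorem stirlingSum_one {R : Type*} [Semiring R] (s : R) : stirlingSum s 1 = s := by
  simp [stirlingSum, Nat.stirlingSecond]

/-- In the Stirling recurrence S(k+1, j) = j S(k, j) + S(k, j-1), the first term contributes X times
the derivative and the second X² times it. -/
theorem stirlingSum_X_succ (k : ℕ) :
    stirlingSum (Polynomial.X : Polynomial ℚ) (k + 2) =
      (Polynomial.X + Polynomial.X ^ 2) *
        Polynomial.derivative (stirlingSum Polynomial.X (k + 1)) := by
  have h1 : Polynomial.derivative (stirlingSum (Polynomial.X : Polynomial ℚ) (k + 1)) =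
      ∑ i ∈ Finset.range (k + 1),
        (((i + 1).factorial * Nat.stirlingSecond (k + 1) (i + 1) : ℕ) : Polynomial ℚ) *
          Polynomial.X ^ i := by
    rw [stirlingSum, Polynomial.derivative_sum]
    refine Finset.sum_congr rfl fun i _ => ?_
    rw [Polynomial.derivative_natCast_mul, Polynomial.derivative_X_pow, Nat.factorial_succ]
    simp only [add_tsub_cancel_right, Polynomial.C_eq_natCast]
    push_cast
    ring
  rw [h1, add_mul, Finset.mul_sum, Finset.mul_sum, stirlingSum]
  have h2 : ∀ i, (((i.factorial * Nat.stirlingSecond (k + 2) (i + 1) : ℕ) : Polynomial ℚ) *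
        Polynomial.X ^ (i + 1)) =
      Polynomial.X * ((((i + 1).factorial * Nat.stirlingSecond (k + 1) (i + 1) : ℕ) :
        Polynomial ℚ) * Polynomial.X ^ i) +
      (((i.factorial * Nat.stirlingSecond (k + 1) i : ℕ) : Polynomial ℚ) *
        Polynomial.X ^ (i + 1)) := by
    intro i
    rw [Nat.stirlingSecond_succ_succ, Nat.factorial_succ]
    push_cast
    ring
  simp_rw [h2, Finset.sum_add_distrib]
  congr 1
  · rw [Finset.sum_range_succ, Nat.stirlingSecond_eq_zero_of_lt (by omega)]
    simp
  · rw [Finset.sum_range_succ']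
    simp only [Nat.stirlingSecond_succ_zero, mul_zero, Nat.cast_zero, zero_mul, add_zero]
    refine Finset.sum_congr rfl fun i _ => ?_
    ring

/-- The operator (X + X²) d/dX raises the index of every Stirling sum by one. Applied to the
identity for n, it gives the identity for n + 1 after Pascal's rule and subtraction of X times the
old identity. -/
theorem stirlingSum_X_recursion (n : ℕ) :
    (1 + Polynomial.X) * stirlingSum (Polynomial.X : Polynomial ℚ) (n + 1) =
      Polynomial.X * (1 + ∑ k ∈ Finset.range (n + 1),
        (n.choose k : Polynomial ℚ) * stirlingSum Polynomial.X (k + 1)) := by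
  induction n with
  | zero => simp [stirlingSum_one]; ring
  | succ n ih =>
    have hd := congrArg Polynomial.derivative ih
    set B : ℕ → Polynomial ℚ := fun k => stirlingSum Polynomial.X (k + 1) with hB
    have hstep : ∀ k, B (k + 1) = (Polynomial.X + Polynomial.X ^ 2) *
      Polynomial.derivative (B k) := fun k => stirlingSum_X_succ k
    change (1 + Polynomial.X) * B n = Polynomial.X * (1 + ∑ k ∈ Finset.range (n + 1),
        (n.choose k : Polynomial ℚ) * B k) at ih
    change Polynomial.derivative ((1 + Polynomial.X) * B n) = Polynomial.derivative
      (Polynomial.X * (1 + ∑ k ∈ Finset.range (n + 1), (n.choose k : Polynomial ℚ) * B k)) at hd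
    change (1 + Polynomial.X) * B (n + 1) = Polynomial.X * (1 + ∑ k ∈ Finset.range (n + 2),
        ((n + 1).choose k : Polynomial ℚ) * B k)
    have hpascal : ∑ k ∈ Finset.range (n + 2), ((n + 1).choose k : Polynomial ℚ) * B k =
        ∑ k ∈ Finset.range (n + 1), (n.choose k : Polynomial ℚ) * B k +
        ∑ k ∈ Finset.range (n + 1), (n.choose k : Polynomial ℚ) * B (k + 1) := by
      rw [Finset.sum_range_succ']
      simp_rw [Nat.choose_succ_succ, Nat.cast_add, add_mul, Finset.sum_add_distrib]
      rw [Finset.sum_range_succ (fun k => ((n.choose (k + 1) : ℕ) : Polynomial ℚ) * B (k + 1)),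
        Finset.sum_range_succ' (fun k => ((n.choose k : ℕ) : Polynomial ℚ) * B k)]
      simp
      ring
    have hT : (Polynomial.X + Polynomial.X ^ 2) * Polynomial.derivative
        (∑ k ∈ Finset.range (n + 1), (n.choose k : Polynomial ℚ) * B k) =
        ∑ k ∈ Finset.range (n + 1), (n.choose k : Polynomial ℚ) * B (k + 1) := by
      rw [Polynomial.derivative_sum, Finset.mul_sum]
      refine Finset.sum_congr rfl fun k _ => ?_
      rw [hstep, Polynomial.derivative_natCast_mul]
      ring
    rw [hpascal, ← hT]
    set T := ∑ k ∈ Finset.range (n + 1), (n.choose k : Polynomial ℚ) * B k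
    rw [Polynomial.derivative_mul, Polynomial.derivative_mul] at hd
    simp only [Polynomial.derivative_add, Polynomial.derivative_one, Polynomial.derivative_X,
      zero_add, one_mul] at hd
    rw [hstep]
    linear_combination (Polynomial.X + Polynomial.X ^ 2) * hd - Polynomial.X * ih

theorem stirlingSum_recursion {R : Type*} [CommRing R] [Algebra ℚ R] (s : R) (n : ℕ) :
    (1 + s) * stirlingSum s (n + 1) =
      s * (1 + ∑ k ∈ Finset.range (n + 1), (n.choose k : R) * stirlingSum s (k + 1)) := by
  have h := congrArg (Polynomial.aeval s) (stirlingSum_X_recursion n)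
  have hm (k : ℕ) : (Polynomial.aeval s) (stirlingSum (Polynomial.X : Polynomial ℚ) k) =
      stirlingSum s k := by
    have := map_stirlingSum (Polynomial.aeval s : Polynomial ℚ →ₐ[ℚ] R).toRingHom Polynomial.X k
    simpa using this
  simpa [hm] using h

/-- The exponential generating series of `stirlingSum s`. -/
def stirlingSeries {R : Type*} [CommRing R] [Algebra ℚ R] (s : R) : R⟦X⟧ :=
  PowerSeries.mk fun k => algebraMap ℚ R (1 / k.factorial) * stirlingSum s k

/-- Coefficientwise this is `stirlingSum_recursion`. It says that the series is -log(1 + s - s e^X),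
without introducing that logarithm. -/
theorem derivative_stirlingSeries {R : Type*} [CommRing R] [Algebra ℚ R] (s : R) :
    d⁄dX R (stirlingSeries s) * (1 + C s - C s * exp R) = C s * exp R := by
  have hc (n : ℕ) : coeff n (d⁄dX R (stirlingSeries s)) =
      algebraMap ℚ R (1 / n.factorial) * stirlingSum s (n + 1) := by
    rw [coeff_derivative, stirlingSeries, coeff_mk, mul_right_comm]
    congr 1
    rw [show ((n : R) + 1) = algebraMap ℚ R (n + 1) by simp, ← map_mul]
    congr 1
    rw [Nat.factorial_succ]
    push_cast
    field_simp
  ext n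
  have hs : d⁄dX R (stirlingSeries s) * (1 + C s - C s * exp R) =
      C (1 + s) * d⁄dX R (stirlingSeries s) - C s * (d⁄dX R (stirlingSeries s) * exp R) := by
    rw [map_add, map_one]; ring
  rw [hs, map_sub, coeff_C_mul, coeff_C_mul, coeff_C_mul, coeff_mul, hc, coeff_exp,
    Finset.Nat.sum_antidiagonal_eq_sum_range_succ
      (fun i j => coeff i (d⁄dX R (stirlingSeries s)) * coeff j (exp R))]
  have h := stirlingSum_recursion s n
  have h2 : ∑ k ∈ Finset.range n.succ,
      coeff k (d⁄dX R (stirlingSeries s)) * coeff (n - k) (exp R) =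
      algebraMap ℚ R (1 / n.factorial) *
        ∑ k ∈ Finset.range (n + 1), (n.choose k : R) * stirlingSum s (k + 1) := by
    rw [Finset.mul_sum]
    refine Finset.sum_congr rfl fun k hk => ?_
    rw [hc, coeff_exp, mul_right_comm, ← mul_assoc, ← map_mul,
      show ((n.choose k : ℕ) : R) = algebraMap ℚ R (n.choose k) by simp, ← map_mul]
    congr 2
    rw [Nat.cast_choose ℚ (by simpa [Nat.lt_succ_iff] using hk)]
    have := Nat.factorial_ne_zero n
    field_simp
  rw [h2]
  linear_combination algebraMap ℚ R (1 / n.factorial) * h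

/-! ### Substitution into power series, by finite sums. -/

section

variable {R : Type*} [CommRing R]

theorem hasSubst_of_constantCoeff {f : R⟦X⟧} (hf : constantCoeff f = 0) : HasSubst f :=
  HasSubst.of_constantCoeff_zero' hf

theorem coeff_pow_eq_zero_of_lt {f : R⟦X⟧} (hf : constantCoeff f = 0) {k n : ℕ} (h : n < k) :
    coeff n (f ^ k) = 0 :=
  X_pow_dvd_iff.mp (pow_dvd_pow_of_dvd (X_dvd_iff.mpr hf) k) n h

theorem coeff_subst_eq_sum {f g : R⟦X⟧} (hg : constantCoeff g = 0) {n N : ℕ} (hN : n ≤ N) :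
    coeff n (f.subst g) = ∑ k ∈ Finset.range (N + 1), coeff k f * coeff n (g ^ k) := by
  rw [coeff_subst' (hasSubst_of_constantCoeff hg)]
  simp only [smul_eq_mul]
  refine finsum_eq_sum_of_support_subset _ fun k hk => ?_
  by_contra hlt
  simp only [Finset.coe_range, Set.mem_Iio, not_lt] at hlt
  exact hk (by simp [coeff_pow_eq_zero_of_lt hg (show n < k by omega)])

/-- The formal sum over even exponents of a power series without odd terms. -/
theorem formalSum_even_pow_eq_subst {f g : R⟦X⟧} (hf : constantCoeff f = 0)
    (hodd : ∀ n, Odd n → coeff n f = 0) (hg : constantCoeff g = 0) :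
    formalSum (fun k => C (coeff (2 * k) f) * g ^ (2 * k)) = f.subst g := by
  ext n
  rw [coeff_subst_eq_sum hg (show n ≤ 2 * n by omega), formalSum, coeff_mk]
  have h0 : ∀ k ∈ Finset.range (2 * n + 1), k ∉ (Finset.Icc 1 n).image (2 * ·) →
      coeff k f * coeff n (g ^ k) = 0 := by
    intro k hk hk'
    rcases Nat.even_or_odd k with ⟨j, rfl⟩ | ho
    · rcases Nat.eq_zero_or_pos j with rfl | hj
      · simp [hf]
      · exfalso
        apply hk'
        simp only [Finset.mem_range] at hk
        simp only [Finset.mem_image, Finset.mem_Icc]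
        exact ⟨j, by omega, by omega⟩
    · simp [hodd k ho]
  rw [← Finset.sum_subset (s₁ := (Finset.Icc 1 n).image (2 * ·)) ?_ h0,
    Finset.sum_image (by intro a _ b _ h; simpa using h)]
  · simp
  · intro k hk
    simp only [Finset.mem_image, Finset.mem_Icc, Finset.mem_range] at hk ⊢
    omega

end

/-! ### Differential equations of 2 arcsin(X/2). -/

section

variable {K : Type*} [Field K]

theorem constantCoeff_twoArcsinHalf (c : K) : constantCoeff (twoArcsinHalf c) = 0 := by
  rw [twoArcsinHalf, map_mul, ← coeff_zero_eq_constantCoeff_apply (rescale _ _), coeff_rescale]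
  simp [arcsinSeries]

theorem coeff_twoArcsinHalf (c : K) (n : ℕ) :
    coeff n (twoArcsinHalf c) = 2 * ((c / 2) ^ n *
      if Odd n then (Nat.centralBinom (n / 2) : K) / (4 ^ (n / 2) * n) else 0) := by
  have : (2 : K⟦X⟧) = C 2 := (map_ofNat C 2).symm
  rw [twoArcsinHalf, this, coeff_C_mul, coeff_rescale, arcsinSeries, coeff_mk]

variable [CharZero K]

theorem coeff_derivative_twoArcsinHalf (j : ℕ) :
    coeff (2 * j) (d⁄dX K (twoArcsinHalf (1 : K))) = (Nat.centralBinom j : K) / 16 ^ j := by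
  have h : (2 * j + 1) / 2 = j := by omega
  have h' : ((2 * j + 1 : ℕ) : K) ≠ 0 := by exact_mod_cast (show 2 * j + 1 ≠ 0 by omega)
  rw [coeff_derivative, coeff_twoArcsinHalf, if_pos ⟨j, rfl⟩, h,
    show (16 : K) = 2 ^ 2 * 4 by norm_num]
  push_cast at h' ⊢
  rw [mul_pow, ← pow_mul, div_pow, one_pow, pow_succ]
  field_simp

omit [CharZero K] in
theorem coeff_derivative_twoArcsinHalf_odd (j : ℕ) :
    coeff (2 * j + 1) (d⁄dX K (twoArcsinHalf (1 : K))) = 0 := by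
  rw [coeff_derivative, coeff_twoArcsinHalf, if_neg (by simp [parity_simps])]
  simp

/-- The first derivative is ∑ binom(2j, j) (X²/16)^j, and the equation is the two-term recurrence of
the central binomial coefficients. -/
theorem derivative_derivative_twoArcsinHalf :
    (4 - X ^ 2) * d⁄dX K (d⁄dX K (twoArcsinHalf (1 : K))) =
      X * d⁄dX K (twoArcsinHalf (1 : K)) := by
  set w := d⁄dX K (twoArcsinHalf (1 : K)) with hw
  have h4 : (4 : K⟦X⟧) = C 4 := (map_ofNat C 4).symm
  have key : ∀ n : ℕ, 4 * (n + 2 : K) * coeff (n + 2) w = (n + 1) * coeff n w := by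
    intro n
    rcases Nat.even_or_odd' n with ⟨j, rfl | rfl⟩
    · rw [show 2 * j + 2 = 2 * (j + 1) by ring, coeff_derivative_twoArcsinHalf,
        coeff_derivative_twoArcsinHalf]
      have h := congrArg (Nat.cast (R := K)) (Nat.succ_mul_centralBinom_succ j)
      push_cast at h ⊢
      rw [pow_succ]
      field_simp
      linear_combination 8 * h
    · rw [show 2 * j + 1 + 2 = 2 * (j + 1) + 1 by ring, coeff_derivative_twoArcsinHalf_odd,
        coeff_derivative_twoArcsinHalf_odd]
      simp
  clear_value w
  ext n
  rw [sub_mul, map_sub, h4, coeff_C_mul, coeff_derivative]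
  rcases n with _ | _ | n
  · have : coeff 1 w = 0 := hw ▸ coeff_derivative_twoArcsinHalf_odd 0
    simp [this, coeff_X_pow_mul']
  · have := key 0
    rw [coeff_X_pow_mul', if_neg (by omega), coeff_succ_X_mul]
    push_cast at this ⊢
    linear_combination this
  · have := key (n + 1)
    rw [coeff_X_pow_mul', if_pos (by omega), coeff_succ_X_mul, coeff_derivative]
    simp only [show n + 1 + 1 - 2 = n by omega]
    push_cast at this ⊢
    linear_combination this

/-- By the second-order equation the left side has derivative zero, so only its constant term
matters. -/
theorem derivative_twoArcsinHalf_sq :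
    (4 - X ^ 2) * d⁄dX K (twoArcsinHalf (1 : K)) ^ 2 = 4 := by
  have hd := derivative_derivative_twoArcsinHalf (K := K)
  have h0 : constantCoeff (d⁄dX K (twoArcsinHalf (1 : K))) = 1 := by
    simpa using coeff_derivative_twoArcsinHalf (K := K) 0
  have h4 : (4 : K⟦X⟧) = C 4 := (map_ofNat C 4).symm
  refine derivative.ext ?_ ?_
  · rw [Derivation.leibniz, derivative_pow, map_sub, derivative_pow, derivative_X, h4,
      derivative_C]
    rw [h4] at hd
    simp only [smul_eq_mul]
    push_cast
    linear_combination 2 * d⁄dX K (twoArcsinHalf (1 : K)) * hd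
  · simp [h0]

end

/-! ### The cosine identity and the logarithm of 1 + (s + s²)X². -/

section

variable {R : Type*} [CommRing R]

theorem constantCoeff_subst_of_constantCoeff {f g : R⟦X⟧} (hg : constantCoeff g = 0) :
    constantCoeff (f.subst g) = constantCoeff f := by
  rw [← coeff_zero_eq_constantCoeff_apply, coeff_subst_eq_sum hg le_rfl]
  simp

variable [Algebra ℚ R]

theorem derivative_exp_subst {f : R⟦X⟧} (hf : constantCoeff f = 0) :
    d⁄dX R ((exp R).subst f) = (exp R).subst f * d⁄dX R f := by
  rw [derivative_subst (hasSubst_of_constantCoeff hf), derivative_exp]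

theorem constantCoeff_exp_subst {f : R⟦X⟧} (hf : constantCoeff f = 0) :
    constantCoeff ((exp R).subst f) = 1 := by
  rw [constantCoeff_subst_of_constantCoeff hf, constantCoeff_exp]

variable [IsAddTorsionFree R]

theorem exp_subst_mul_exp_subst_neg {f : R⟦X⟧} (hf : constantCoeff f = 0) :
    (exp R).subst f * (exp R).subst (-f) = 1 := by
  have hf' : constantCoeff (-f) = 0 := by simp [hf]
  refine derivative.ext ?_ ?_
  · rw [Derivation.leibniz, derivative_exp_subst hf, derivative_exp_subst hf', map_neg,
      derivative_one, smul_eq_mul, smul_eq_mul]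
    ring
  · simp [constantCoeff_exp_subst hf, constantCoeff_exp_subst hf']

omit [Algebra ℚ R] in
/-- The uniqueness of the solution of `(4 - X²) T'' = X T' - 4 T` with given initial values. -/
theorem eq_of_chebyshev_ode {T : R⟦X⟧}
    (h : (4 - X ^ 2) * d⁄dX R (d⁄dX R T) = X * d⁄dX R T - 4 * T)
    (h0 : coeff 0 T = 2) (h1 : coeff 1 T = 0) : T = 2 - X ^ 2 := by
  have h4 : (4 : R⟦X⟧) = C 4 := (map_ofNat C 4).symm
  have h2 : (2 : R⟦X⟧) = C 2 := (map_ofNat C 2).symm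
  have htf {m : ℕ} (hm : m ≠ 0) {x y : R} (hxy : (m : R) * x = m * y) : x = y := by
    rw [← nsmul_eq_mul, ← nsmul_eq_mul] at hxy
    exact nsmul_right_injective hm hxy
  have hc (n : ℕ) := congrArg (coeff n) h
  simp only [sub_mul, h4, map_sub, coeff_C_mul] at hc
  -- The factor n² - 4 vanishes at n = 2, so the even coefficients stop after X²; the odd ones
  -- vanish with the first.
  have hrec (n : ℕ) : ((4 * ((n + 2) * (n + 1)) : ℕ) : R) * coeff (n + 2) T =
      ((n : R) ^ 2 - 4) * coeff n T := by
    have := hc n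
    rcases n with _ | _ | n
    · simp only [coeff_derivative, coeff_X_pow_mul'] at this
      simp at this
      rw [coeff_zero_eq_constantCoeff_apply]
      push_cast
      linear_combination this
    · rw [coeff_X_pow_mul', if_neg (by omega), coeff_succ_X_mul] at this
      simp only [coeff_derivative] at this
      push_cast at this ⊢
      linear_combination this
    · rw [coeff_X_pow_mul', if_pos (by omega), coeff_succ_X_mul] at this
      simp only [coeff_derivative, show n + 1 + 1 - 2 = n by omega] at this
      push_cast at this ⊢
      linear_combination this
  have hT2 : coeff 2 T = -1 := by
    have := hrec 0
    refine htf (m := 8) (by norm_num) ?_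
    rw [h0] at this
    push_cast at this ⊢
    linear_combination this
  have hT4 : coeff 4 T = 0 := by
    have := hrec 2
    refine htf (m := 48) (by norm_num) ?_
    push_cast at this ⊢
    linear_combination this
  have heven : ∀ j, coeff (2 * j + 4) T = 0 := by
    intro j
    induction j with
    | zero => exact hT4
    | succ j ih =>
      have := hrec (2 * j + 4)
      rw [ih, mul_zero] at this
      exact htf (m := 4 * ((2 * j + 4 + 2) * (2 * j + 4 + 1))) (by positivity)
        (by rw [mul_zero]; exact this)
  have hodd : ∀ j, coeff (2 * j + 1) T = 0 := by
    intro j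
    induction j with
    | zero => exact h1
    | succ j ih =>
      have := hrec (2 * j + 1)
      rw [ih, mul_zero] at this
      exact htf (m := 4 * ((2 * j + 1 + 2) * (2 * j + 1 + 1))) (by positivity)
        (by rw [mul_zero]; exact this)
  ext n
  rw [map_sub, h2, coeff_C, coeff_X_pow]
  rcases Nat.even_or_odd' n with ⟨j, rfl | rfl⟩
  · rcases j with _ | _ | j
    · simpa using h0
    · simpa using hT2
    · have := heven j
      rw [show 2 * (j + 1 + 1) = 2 * j + 4 by ring, this]
      simp
  · rw [hodd]
    simp

/-- `2 cos (2 arcsin (X / 2)) = 2 - X²`, for any power series `θ` satisfying the differential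
equations of `2 arcsin (X / 2)`. -/
theorem exp_subst_add_exp_subst_neg {θ : R⟦X⟧} {I : R} (hI : I * I = -1)
    (hθ : constantCoeff θ = 0)
    (h1 : (4 - X ^ 2) * d⁄dX R (d⁄dX R θ) = X * d⁄dX R θ)
    (h2 : (4 - X ^ 2) * d⁄dX R θ ^ 2 = 4) :
    (exp R).subst (C I * θ) + (exp R).subst (-(C I * θ)) = 2 - X ^ 2 := by
  have hIθ : constantCoeff (C I * θ) = 0 := by simp [hθ]
  have hIθ' : constantCoeff (-(C I * θ)) = 0 := by simp [hθ]
  have hCI : (C I * C I : R⟦X⟧) = -1 := by rw [← map_mul, hI]; simp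
  have d1 := derivative_exp_subst hIθ
  have d2 := derivative_exp_subst hIθ'
  have dθ : d⁄dX R (C I * θ) = C I * d⁄dX R θ := by
    rw [Derivation.leibniz, derivative_C]; simp
  rw [dθ] at d1
  rw [map_neg, dθ] at d2
  have e1 := constantCoeff_exp_subst hIθ
  have e2 := constantCoeff_exp_subst hIθ'
  generalize (exp R).subst (C I * θ) = E at *
  generalize (exp R).subst (-(C I * θ)) = E' at *
  have dT : d⁄dX R (E + E') = C I * d⁄dX R θ * (E - E') := by
    rw [map_add, d1, d2]; ring
  have dT2 : d⁄dX R (d⁄dX R (E + E')) =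
      C I * d⁄dX R (d⁄dX R θ) * (E - E') - d⁄dX R θ ^ 2 * (E + E') := by
    rw [dT]
    simp only [Derivation.leibniz, map_sub, d1, d2, derivative_C, smul_eq_mul]
    linear_combination d⁄dX R θ ^ 2 * (E + E') * hCI
  -- T = E + E' plays the role of 2 cos θ: multiplying T'' by 4 - X² and using both equations for θ
  -- gives the Chebyshev equation.
  refine eq_of_chebyshev_ode ?_ ?_ ?_
  · rw [dT2, dT]
    linear_combination C I * (E - E') * h1 - (E + E') * h2
  · rw [coeff_zero_eq_constantCoeff_apply, map_add, e1, e2]; norm_num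
  · have := congrArg constantCoeff dT
    rw [map_mul, map_sub, e1, e2, sub_self, mul_zero, ← coeff_zero_eq_constantCoeff_apply,
      coeff_derivative] at this
    simpa using this

/-- The logarithm `log (1 + u X²)`. -/
def logOneAddSq (u : R) : R⟦X⟧ :=
  PowerSeries.mk fun n =>
    if Even n then algebraMap ℚ R ((-1) ^ (n / 2 - 1) / (n / 2 : ℕ)) * u ^ (n / 2) else 0

omit [IsAddTorsionFree R] in
theorem derivative_logOneAddSq (u : R) :
    d⁄dX R (logOneAddSq u) * (1 + C u * X ^ 2) = 2 * (C u * X) := by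
  have h2 : (2 : R⟦X⟧) = C 2 := (map_ofNat C 2).symm
  have hodd (j : ℕ) : coeff (2 * j) (d⁄dX R (logOneAddSq u)) = 0 := by
    rw [coeff_derivative, logOneAddSq, coeff_mk, if_neg (by simp [parity_simps]), zero_mul]
  have heven (j : ℕ) : coeff (2 * j + 1) (d⁄dX R (logOneAddSq u)) =
      2 * (-1) ^ j * u ^ (j + 1) := by
    rw [coeff_derivative, logOneAddSq, coeff_mk, if_pos (by simp [parity_simps]),
      show (2 * j + 1 + 1) / 2 = j + 1 by omega, mul_right_comm]
    congr 1
    rw [show (((2 * j + 1 : ℕ) : R) + 1) = algebraMap ℚ R (2 * (j + 1)) by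
        rw [map_mul, map_ofNat]; simp; ring, ← map_mul,
      show (2 * (-1) ^ j : R) = algebraMap ℚ R (2 * (-1) ^ j) by
        rw [map_mul, map_ofNat]; simp]
    congr 1
    have : ((j : ℚ) + 1) ≠ 0 := by positivity
    push_cast
    field_simp
  rw [mul_add, mul_one, mul_left_comm]
  ext n
  rw [map_add, coeff_C_mul, h2, coeff_C_mul, coeff_C_mul, coeff_mul_X_pow', coeff_X]
  rcases Nat.even_or_odd' n with ⟨j, rfl | rfl⟩
  · rw [hodd]
    rcases j with _ | j
    · simp
    · rw [if_pos (by omega), show 2 * (j + 1) - 2 = 2 * j by omega, hodd, if_neg (by omega)]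
      simp
  · rw [heven]
    rcases j with _ | j
    · simp
    · rw [if_pos (by omega), show 2 * (j + 1) + 1 - 2 = 2 * j + 1 by omega, heven,
        if_neg (by omega)]
      ring

omit [IsAddTorsionFree R] in
theorem constantCoeff_logOneAddSq (u : R) : constantCoeff (logOneAddSq u) = 0 := by
  rw [← coeff_zero_eq_constantCoeff_apply, logOneAddSq, coeff_mk]
  simp

/-- The identity `log (1 + (s + s²) X²) = -∑_{±} P(± i θ)`, where `P` is the exponential generating
series of the Stirling sums. -/
theorem stirlingSeries_subst_add {θ : R⟦X⟧} {I : R} (s : R) (hI : I * I = -1)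
    (hθ : constantCoeff θ = 0)
    (h1 : (4 - X ^ 2) * d⁄dX R (d⁄dX R θ) = X * d⁄dX R θ)
    (h2 : (4 - X ^ 2) * d⁄dX R θ ^ 2 = 4) :
    -((stirlingSeries s).subst (C I * θ) + (stirlingSeries s).subst (-(C I * θ))) =
      logOneAddSq (s + s ^ 2) := by
  have hIθ : constantCoeff (C I * θ) = 0 := by simp [hθ]
  have hIθ' : constantCoeff (-(C I * θ)) = 0 := by simp [hθ]
  have dθ : d⁄dX R (C I * θ) = C I * d⁄dX R θ := by
    rw [Derivation.leibniz, derivative_C]; simp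
  have hP (f : R⟦X⟧) (hf : constantCoeff f = 0) :
      (d⁄dX R (stirlingSeries s)).subst f * (1 + C s - C s * (exp R).subst f) =
        C s * (exp R).subst f := by
    have hs := hasSubst_of_constantCoeff hf
    have h := congrArg (substAlgHom hs) (derivative_stirlingSeries s)
    have hC : substAlgHom hs (C s) = C s := (substAlgHom (R := R) hs).commutes s
    simpa only [map_mul, map_add, map_sub, map_one, hC, coe_substAlgHom] using h
  have hE := exp_subst_add_exp_subst_neg hI hθ h1 h2
  have hEE := exp_subst_mul_exp_subst_neg hIθ
  have hdE := congrArg (d⁄dX R) hE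
  rw [map_add, derivative_exp_subst hIθ, derivative_exp_subst hIθ', map_neg, dθ, map_sub,
    derivative_pow, derivative_X, ← map_ofNat (C (R := R)) 2, derivative_C] at hdE
  have p1 := hP _ hIθ
  have p2 := hP _ hIθ'
  refine derivative.ext ?_ ?_
  -- The derivatives are compared after multiplication by the unit 1 + (s + s²)X², which clears the
  -- denominators of all three logarithmic derivatives.
  · have hu : IsUnit (1 + C (s + s ^ 2) * X ^ 2 : R⟦X⟧) := by
      rw [isUnit_iff_constantCoeff]; simp
    refine hu.mul_right_cancel ?_
    rw [derivative_logOneAddSq, map_neg, map_add,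
      derivative_subst (hasSubst_of_constantCoeff hIθ),
      derivative_subst (hasSubst_of_constantCoeff hIθ'), map_neg, dθ]
    generalize (exp R).subst (C I * θ) = E at *
    generalize (exp R).subst (-(C I * θ)) = E' at *
    generalize (d⁄dX R (stirlingSeries s)).subst (C I * θ) = p at *
    generalize (d⁄dX R (stirlingSeries s)).subst (-(C I * θ)) = p' at *
    -- The key factorization, from E E' = 1 and E + E' = 2 - X².
    have hD : (1 + C (s + s ^ 2) * X ^ 2 : R⟦X⟧) = (1 + C s - C s * E) * (1 + C s - C s * E') := by
      rw [map_add, map_pow]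
      linear_combination (C s + C s ^ 2) * hE - C s ^ 2 * hEE
    rw [hD, map_add, map_pow]
    push_cast at hdE
    linear_combination (-(C I * d⁄dX R θ) * (1 + C s - C s * E')) * p1 +
      ((C I * d⁄dX R θ) * (1 + C s - C s * E)) * p2 - (C s + C s ^ 2) * hdE
  · rw [map_neg, map_add, constantCoeff_subst_of_constantCoeff hIθ,
      constantCoeff_subst_of_constantCoeff hIθ', constantCoeff_logOneAddSq,
      ← coeff_zero_eq_constantCoeff_apply, stirlingSeries, coeff_mk]
    simp [stirlingSum]

end

/-! ### Change of coefficient ring. -/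

theorem map_twoArcsinHalf {K L : Type*} [Field K] [Field L] (f : K →+* L) (c : K) :
    map f (twoArcsinHalf c) = twoArcsinHalf (f c) := by
  ext n
  rw [coeff_map, coeff_twoArcsinHalf, coeff_twoArcsinHalf]
  split_ifs <;> simp [map_ofNat]

theorem twoArcsinHalf_eq_rescale {K : Type*} [Field K] (c : K) :
    twoArcsinHalf c = rescale c (twoArcsinHalf 1) := by
  ext n
  rw [coeff_rescale, coeff_twoArcsinHalf, coeff_twoArcsinHalf, div_eq_mul_one_div c, mul_pow]
  ring

theorem map_coeff_logOneAddSq {R S : Type*} [CommRing R] [Algebra ℚ R] [CommRing S] [Algebra ℚ S]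
    (f : R →+* S) (u : R) (n : ℕ) :
    f (coeff n (logOneAddSq u)) = coeff n (logOneAddSq (f u)) := by
  rw [logOneAddSq, logOneAddSq, coeff_mk, coeff_mk]
  split_ifs
  · rw [map_mul, map_pow, RingHom.map_rat_algebraMap]
  · simp

section

variable {R : Type*} [CommRing R] [Algebra ℚ R] [IsAddTorsionFree R]

/-- The factor I^k + (-I)^k vanishes for odd k and equals 2(-1)^{k/2} for even k, so
`stirlingSeries_subst_add` becomes an expansion in even powers of θ. -/
theorem formalSum_stirlingSum {θ : R⟦X⟧} {I : R} (s : R) (hI : I * I = -1)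
    (hθ : constantCoeff θ = 0)
    (h1 : (4 - X ^ 2) * d⁄dX R (d⁄dX R θ) = X * d⁄dX R θ)
    (h2 : (4 - X ^ 2) * d⁄dX R θ ^ 2 = 4) :
    formalSum (fun k => C (algebraMap ℚ R (-2 * (-1) ^ k / (2 * k).factorial) *
      stirlingSum s (2 * k)) * θ ^ (2 * k)) = logOneAddSq (s + s ^ 2) := by
  rw [← stirlingSeries_subst_add s hI hθ h1 h2]
  have hIθ : constantCoeff (C I * θ) = 0 := by simp [hθ]
  have hIθ' : constantCoeff (-(C I * θ)) = 0 := by simp [hθ]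
  set H : R⟦X⟧ := -(rescale I (stirlingSeries s) + rescale (-I) (stirlingSeries s)) with hH
  have hc (k : ℕ) : coeff k H = -(I ^ k + (-I) ^ k) * coeff k (stirlingSeries s) := by
    rw [hH, map_neg, map_add, coeff_rescale, coeff_rescale]; ring
  have hHθ : -((stirlingSeries s).subst (C I * θ) + (stirlingSeries s).subst (-(C I * θ))) =
      H.subst θ := by
    ext n
    rw [map_neg, map_add, coeff_subst_eq_sum hIθ le_rfl, coeff_subst_eq_sum hIθ' le_rfl,
      coeff_subst_eq_sum hθ le_rfl, ← Finset.sum_add_distrib, ← Finset.sum_neg_distrib]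
    refine Finset.sum_congr rfl fun k _ => ?_
    rw [hc, ← neg_mul, ← map_neg, mul_pow, mul_pow, ← map_pow, ← map_pow, coeff_C_mul,
      coeff_C_mul]
    ring
  rw [hHθ, ← formalSum_even_pow_eq_subst _ _ hθ]
  · congr 1
    ext1 k
    congr 2
    rw [hc, stirlingSeries, coeff_mk, (even_two_mul k).neg_pow, pow_mul, pow_two, hI, ← mul_assoc]
    congr 1
    rw [show -((-1) ^ k + (-1) ^ k : R) = algebraMap ℚ R (-2 * (-1) ^ k) by
      rw [map_mul, map_neg, map_ofNat, map_pow, map_neg, map_one]; ring, ← map_mul]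
    congr 1
    ring
  · rw [← coeff_zero_eq_constantCoeff_apply, hc, stirlingSeries, coeff_mk]
    simp [stirlingSum]
  · intro n hn
    rw [hc, hn.neg_pow]
    ring

end

/-- The identity has rational coefficients but its derivation needs a square root of -1. It is
therefore checked in ℂ[s] and pulled back along the injection of ℚ[s]. -/
theorem sum_coeff_twoArcsinHalf_mul_stirlingSum_X (N : ℕ) :
    ∑ k ∈ Finset.Icc 1 N, Polynomial.C (-2 * (-1) ^ k / ((2 * k).factorial : ℚ) *
        coeff N (twoArcsinHalf (1 : ℚ) ^ (2 * k))) * stirlingSum Polynomial.X (2 * k) =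
      coeff N (logOneAddSq (Polynomial.X + Polynomial.X ^ 2 : Polynomial ℚ)) := by
  apply Polynomial.map_injective (algebraMap ℚ ℂ) (algebraMap ℚ ℂ).injective
  change Polynomial.mapRingHom (algebraMap ℚ ℂ) _ = Polynomial.mapRingHom (algebraMap ℚ ℂ) _
  rw [map_coeff_logOneAddSq]
  simp only [map_add, map_pow, Polynomial.coe_mapRingHom, Polynomial.map_X]
  let θ : (Polynomial ℂ)⟦X⟧ := map Polynomial.C (twoArcsinHalf (1 : ℂ))
  have hdd (f : ℂ⟦X⟧) : d⁄dX (Polynomial ℂ) (map Polynomial.C f) =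
      map Polynomial.C (d⁄dX ℂ f) := by
    ext1 n
    simp [coeff_derivative]
  have hθ : constantCoeff θ = 0 := by
    rw [← coeff_zero_eq_constantCoeff_apply, coeff_map, coeff_zero_eq_constantCoeff_apply,
      constantCoeff_twoArcsinHalf, map_zero]
  have h1 : (4 - X ^ 2) * d⁄dX (Polynomial ℂ) (d⁄dX (Polynomial ℂ) θ) =
      X * d⁄dX (Polynomial ℂ) θ := by
    have := congrArg (map (Polynomial.C (R := ℂ)))
      (derivative_derivative_twoArcsinHalf (K := ℂ))
    rw [map_mul, map_mul, map_sub, map_pow, map_X, map_ofNat, ← hdd, ← hdd] at this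
    exact this
  have h2 : (4 - X ^ 2) * d⁄dX (Polynomial ℂ) θ ^ 2 = 4 := by
    have := congrArg (map (Polynomial.C (R := ℂ))) (derivative_twoArcsinHalf_sq (K := ℂ))
    rw [map_mul, map_sub, map_pow, map_pow, map_X, map_ofNat, ← hdd] at this
    exact this
  have hI : (Polynomial.C Complex.I * Polynomial.C Complex.I : Polynomial ℂ) = -1 := by
    rw [← map_mul, Complex.I_mul_I, map_neg, map_one]
  have h := formalSum_stirlingSum Polynomial.X hI hθ h1 h2
  rw [← h, formalSum, coeff_mk, Polynomial.map_sum]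
  refine Finset.sum_congr rfl fun k _ => ?_
  rw [Polynomial.map_mul, Polynomial.map_C, coeff_C_mul]
  have hs : (stirlingSum (Polynomial.X : Polynomial ℚ) (2 * k)).map (algebraMap ℚ ℂ) =
      stirlingSum (Polynomial.X : Polynomial ℂ) (2 * k) := by
    have := map_stirlingSum (Polynomial.mapRingHom (algebraMap ℚ ℂ)) Polynomial.X (2 * k)
    simpa using this
  have ht : coeff N (θ ^ (2 * k)) = Polynomial.C (algebraMap ℚ ℂ
      (coeff N (twoArcsinHalf (1 : ℚ) ^ (2 * k)))) := by
    rw [← coeff_map (algebraMap ℚ ℂ), map_pow (map _), map_twoArcsinHalf, map_one, ← coeff_map,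
      map_pow (map _)]
  rw [hs, ht, map_mul, map_mul, mul_right_comm]
  rfl

/-- The coefficients of `log (1 + (s + s²) (c X)²)` as combinations of Stirling sums. -/
theorem sum_coeff_twoArcsinHalf_mul_stirlingSum {K R : Type*} [Field K] [CharZero K] [CommRing R]
    [Algebra K R] [Algebra ℚ R] (c : K) (s : R) (N : ℕ) :
    ∑ k ∈ Finset.Icc 1 N, algebraMap K R (2 * ((-1) ^ (k - 1) / ((2 * k).factorial : K) *
        coeff N (twoArcsinHalf c ^ (2 * k)))) * stirlingSum s (2 * k) =
      algebraMap K R (c ^ N) * coeff N (logOneAddSq (s + s ^ 2)) := by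
  have h := congrArg (Polynomial.aeval s : Polynomial ℚ →ₐ[ℚ] R).toRingHom
    (sum_coeff_twoArcsinHalf_mul_stirlingSum_X N)
  rw [map_coeff_logOneAddSq, map_sum] at h
  simp only [map_mul _ (Polynomial.C _), map_stirlingSum] at h
  simp only [map_add, map_pow, AlgHom.toRingHom_eq_coe, RingHom.coe_coe, Polynomial.aeval_X,
    Polynomial.aeval_C] at h
  rw [← h, Finset.mul_sum]
  refine Finset.sum_congr rfl fun k hk => ?_
  rw [← mul_assoc (algebraMap K R (c ^ N))]
  congr 1
  -- Since k ≥ 1, the truncated exponent is genuine and -2(-1)^k = 2(-1)^{k-1}.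
  obtain ⟨k, rfl⟩ : ∃ j, k = j + 1 := ⟨k - 1, by simp only [Finset.mem_Icc] at hk; omega⟩
  have ht : coeff N (twoArcsinHalf c ^ (2 * (k + 1))) =
      c ^ N * algebraMap ℚ K (coeff N (twoArcsinHalf 1 ^ (2 * (k + 1)))) := by
    rw [twoArcsinHalf_eq_rescale c, ← map_pow, coeff_rescale, ← coeff_map, map_pow (map _),
      map_twoArcsinHalf, map_one]
  rw [← RingHom.map_rat_algebraMap (algebraMap K R), ← map_mul, ht]
  congr 1
  simp only [map_mul, map_div₀, map_neg, map_pow, map_one, map_ofNat, map_natCast,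
    add_tsub_cancel_right]
  ring

/-! ### The products ∘ and *, and a Newton-type identity. -/

section

variable (K : Type*) [Field K]

theorem toH1_single (u : Letter) (c : Coeff K) :
    toH1 K (Finsupp.single u c) = c • FreeAlgebra.ι (Coeff K) u := by
  simp [toH1]

theorem circ_single_single (u v : Letter) :
    circ K (Finsupp.single u 1) (Finsupp.single v 1) = letterCirc K u v := by
  simp [circ]

theorem letterCirc_comm (u v : Letter) : letterCirc K u v = letterCirc K v u := by
  cases u <;> cases v <;> simp [letterCirc, add_comm]

/-- Bilinear maps out of `𝔷` are determined by their values on letters. -/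
theorem linearMap_ext_letter {M : Type*} [AddCommMonoid M] [Module (Coeff K) M]
    {f f' : Z K →ₗ[Coeff K] M}
    (h : ∀ u, f (Finsupp.single u 1) = f' (Finsupp.single u 1)) : f = f' :=
  Finsupp.lhom_ext' fun u => LinearMap.ext_ring (h u)

theorem circ_comm (u v : Z K) : circ K u v = circ K v u := by
  have : circ K = (circ K).flip := linearMap_ext_letter K fun u => linearMap_ext_letter K fun v => by
    rw [LinearMap.flip_apply, circ_single_single, circ_single_single, letterCirc_comm]
  exact congrArg (fun f => f u v) this

theorem circ_assoc (u v w : Z K) : circ K (circ K u v) w = circ K u (circ K v w) := by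
  have h1 (x y z : Letter) : circ K (letterCirc K x y) (Finsupp.single z 1) =
      circ K (Finsupp.single x 1) (letterCirc K y z) := by
    cases x <;> cases y <;> cases z <;> simp [letterCirc, circ, add_assoc]
  have h2 (x y : Letter) : circ K (letterCirc K x y) =
      circ K (Finsupp.single x 1) ∘ₗ circ K (Finsupp.single y 1) :=
    linearMap_ext_letter K fun z => by
      rw [LinearMap.comp_apply, circ_single_single, h1]
  have h3 (x : Letter) : (circ K).flip w ∘ₗ circ K (Finsupp.single x 1) =
      circ K (Finsupp.single x 1) ∘ₗ (circ K).flip w :=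
    linearMap_ext_letter K fun y => by
      simp only [LinearMap.comp_apply, LinearMap.flip_apply]
      rw [circ_single_single, h2, LinearMap.comp_apply]
  have h4 : (circ K).flip w ∘ₗ (circ K).flip v = (circ K).flip (circ K v w) :=
    linearMap_ext_letter K fun x => congrArg (fun f => f v) (h3 x)
  exact congrArg (fun f => f u) h4

theorem circ_right_comm (u v w : Z K) : circ K (circ K u v) w = circ K (circ K u w) v := by
  rw [circ_assoc, circ_assoc, circ_comm K v w]

/-- The recursion for the harmonic product with an element of `𝔷`. -/
theorem harm_mul_toH1 (x : H1 K) (u v : Z K) :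
    harm K (x * toH1 K u) (toH1 K v) =
      harm K x (toH1 K v) * toH1 K u + x * toH1 K u * toH1 K v + x * toH1 K (circ K u v) := by
  let L := LinearMap.mulLeft (Coeff K) x
  let m := LinearMap.mul (Coeff K) (H1 K)
  have key : (harm K).compl₁₂ (L ∘ₗ toH1 K) (toH1 K) =
      (m.compl₁₂ (harm K x ∘ₗ toH1 K) (toH1 K)).flip + m.compl₁₂ (L ∘ₗ toH1 K) (toH1 K) +
        (circ K).compr₂ (L ∘ₗ toH1 K) := by
    refine linearMap_ext_letter K fun u => linearMap_ext_letter K fun v => ?_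
    have := harm_mul_letter K x 1 u v
    simp only [one_mul, harm_one] at this
    simpa [toH1_single, L, m] using this
  exact congrArg (fun f => f u v) key

/-- Harmonic multiplications by elements of `𝔷` commute. -/
theorem harm_toH1_right_comm (x : H1 K) (u v : Z K) :
    harm K (harm K x (toH1 K u)) (toH1 K v) = harm K (harm K x (toH1 K v)) (toH1 K u) := by
  let D (v : Z K) := (harm K).flip (toH1 K v)
  have key : D v ∘ₗ D u = D u ∘ₗ D v := linearMap_ext_word K fun l => by
    induction l using List.reverseRecOn with
    | nil =>
      have h := harm_mul_toH1 K 1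
      simp only [one_mul, one_harm] at h
      simp only [D, word, List.map_nil, List.prod_nil, LinearMap.comp_apply,
        LinearMap.flip_apply, one_harm, h]
      rw [circ_comm K u v]
      abel
    | append_singleton l y ih =>
      have hw : word K (l ++ [y]) = word K l * toH1 K (Finsupp.single y 1) := by
        simp [word, toH1_single]
      generalize word K l = x at *
      generalize (Finsupp.single y 1 : Z K) = z at *
      simp only [D, LinearMap.comp_apply, LinearMap.flip_apply] at ih ⊢
      -- Expanding both sides at the last letter z leaves terms exchanged in pairs by u ↔ v, apart
      -- from the one governed by the induction hypothesis and those handled by commutativity and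
      -- associativity of ∘.
      simp only [hw, harm_mul_toH1, map_add, LinearMap.add_apply, ih]
      rw [circ_right_comm K z u v, circ_comm K u v]
      noncomm_ring
  exact congrArg (fun f => f x) key

variable {K}

theorem circPow_succ (u : Z K) {n : ℕ} (hn : n ≠ 0) :
    circPow K u (n + 1) = circ K (circPow K u n) u := by
  obtain ⟨n, rfl⟩ := Nat.exists_eq_succ_of_ne_zero hn
  rfl

/-- The sum `∑_{i = 0}^{m} u ^ i v u ^ {m - i}` of all words with one letter `v` inserted
into `u ^ m`. -/
def insertSum (u v : Z K) : ℕ → H1 K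
  | 0 => toH1 K v
  | m + 1 => insertSum u v m * toH1 K u + toH1 K u ^ (m + 1) * toH1 K v

theorem insertSum_self (u : Z K) (m : ℕ) : insertSum u u m = (m + 1 : Coeff K) • toH1 K u ^ (m + 1) := by
  induction m with
  | zero => simp [insertSum]
  | succ m ih => rw [insertSum, ih, smul_mul_assoc, ← pow_succ]; push_cast; module

/-- The new letter is either inserted in one of the m + 2 gaps of the word, or merged with one of
its m + 1 letters. -/
theorem harm_pow_toH1 (u v : Z K) (m : ℕ) :
    harm K (toH1 K u ^ (m + 1)) (toH1 K v) =
      insertSum u v (m + 1) + insertSum u (circ K v u) m := by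
  induction m with
  | zero =>
    have h := harm_mul_toH1 K 1 u v
    simp only [one_mul, one_harm] at h
    simp only [zero_add, pow_one, h, insertSum, circ_comm K u v]
  | succ m ih =>
    rw [pow_succ, harm_mul_toH1, ih]
    simp only [insertSum, circ_comm K u v]
    noncomm_ring

/-- By `harm_pow_toH1` each product is a sum of an insertion of u^{∘(j+1)} and an insertion of
u^{∘(j+2)}. With alternating signs these telescope, leaving the insertions of u into u^n. This is
the analogue of Newton's identities, with words u^n as elementary symmetric functions and ∘-powers
as power sums. -/
theorem sum_harm_pow_circPow (u : Z K) (n : ℕ) :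
    ∑ j ∈ Finset.range (n + 1),
      (-1 : Coeff K) ^ j • harm K (toH1 K u ^ (n - j)) (toH1 K (circPow K u (j + 1))) =
      (n + 1 : Coeff K) • toH1 K u ^ (n + 1) := by
  have htel : ∀ m ≤ n, ∑ j ∈ Finset.range m,
      (-1 : Coeff K) ^ j • harm K (toH1 K u ^ (n - j)) (toH1 K (circPow K u (j + 1))) +
        (-1 : Coeff K) ^ m • insertSum u (circPow K u (m + 1)) (n - m) = insertSum u u n := by
    intro m hm
    induction m with
    | zero => simp [circPow]
    | succ m ih =>
      rw [← ih (by omega), Finset.sum_range_succ, show n - m = (n - (m + 1)) + 1 by omega,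
        harm_pow_toH1, circPow_succ u (n := m + 1) (by omega), smul_add, add_assoc, add_assoc,
        ← add_smul, show (-1 : Coeff K) ^ m + (-1) ^ (m + 1) = 0 by ring, zero_smul, add_zero]
  rw [← insertSum_self, ← htel n le_rfl, Finset.sum_range_succ]
  simp [one_harm, insertSum]

end

/-! ### Harmonic exponentials through the derivation X d/dX. -/

section

variable {K : Type*} [Field K]

theorem coeff_harmSeries (f f' : (H1 K)⟦X⟧) (n : ℕ) :
    coeff n (harmSeries f f') =
      ∑ p ∈ Finset.HasAntidiagonal.antidiagonal n, harm K (coeff p.1 f) (coeff p.2 f') := by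
  rw [harmSeries, coeff_mk]

theorem harmSeries_right_comm (x f f' : (H1 K)⟦X⟧) (hf : ∀ n, ∃ v, coeff n f = toH1 K v)
    (hf' : ∀ n, ∃ v, coeff n f' = toH1 K v) :
    harmSeries (harmSeries x f) f' = harmSeries (harmSeries x f') f := by
  ext n
  simp only [coeff_harmSeries, map_sum, LinearMap.sum_apply, Finset.sum_sigma']
  -- The reindexing exchanges the exponents taken from f and f'; it is an involution, so it serves
  -- as its own inverse.
  refine Finset.sum_nbij' (fun p => ⟨(p.2.1 + p.1.2, p.2.2), (p.2.1, p.1.2)⟩)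
    (fun p => ⟨(p.2.1 + p.1.2, p.2.2), (p.2.1, p.1.2)⟩) ?_ ?_ ?_ ?_ ?_
  · rintro ⟨⟨a, b⟩, ⟨p, q⟩⟩ h
    simp only [Finset.mem_sigma, Finset.HasAntidiagonal.mem_antidiagonal] at h ⊢
    obtain ⟨rfl, rfl⟩ := h
    exact ⟨add_right_comm _ _ _, trivial⟩
  · rintro ⟨⟨a, b⟩, ⟨p, q⟩⟩ h
    simp only [Finset.mem_sigma, Finset.HasAntidiagonal.mem_antidiagonal] at h ⊢
    obtain ⟨rfl, rfl⟩ := h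
    exact ⟨add_right_comm _ _ _, trivial⟩
  · rintro ⟨⟨a, b⟩, ⟨p, q⟩⟩ h
    simp only [Finset.mem_sigma, Finset.HasAntidiagonal.mem_antidiagonal] at h ⊢
    obtain ⟨_, rfl⟩ := h
    rfl
  · rintro ⟨⟨a, b⟩, ⟨p, q⟩⟩ h
    simp only [Finset.mem_sigma, Finset.HasAntidiagonal.mem_antidiagonal] at h ⊢
    obtain ⟨_, rfl⟩ := h
    rfl
  · rintro ⟨⟨a, b⟩, ⟨p, q⟩⟩ _
    obtain ⟨v, hv⟩ := hf q
    obtain ⟨v', hv'⟩ := hf' b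
    simp only [hv, hv', harm_toH1_right_comm]

/-- The derivation `X d/dX`. -/
def euler (f : (H1 K)⟦X⟧) : (H1 K)⟦X⟧ := PowerSeries.mk fun n => (n : Coeff K) • coeff n f

theorem coeff_euler (f : (H1 K)⟦X⟧) (n : ℕ) : coeff n (euler f) = (n : Coeff K) • coeff n f := by
  rw [euler, coeff_mk]

theorem coeff_euler_harmSeries (f f' : (H1 K)⟦X⟧) (n : ℕ) :
    coeff n (euler (harmSeries f f')) =
      coeff n (harmSeries (euler f) f') + coeff n (harmSeries f (euler f')) := by
  simp only [coeff_euler, coeff_harmSeries, Finset.smul_sum, ← Finset.sum_add_distrib]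
  refine Finset.sum_congr rfl fun p hp => ?_
  rw [← Finset.HasAntidiagonal.mem_antidiagonal.mp hp, map_smul, map_smul, LinearMap.smul_apply, Nat.cast_add,
    add_smul]

theorem exists_coeff_euler {f : (H1 K)⟦X⟧} (hf : ∀ n, ∃ v, coeff n f = toH1 K v) (n : ℕ) :
    ∃ v, coeff n (euler f) = toH1 K v := by
  obtain ⟨v, hv⟩ := hf n
  exact ⟨(n : Coeff K) • v, by rw [coeff_euler, hv, map_smul]⟩

theorem harmPow_succ (f : (H1 K)⟦X⟧) (k : ℕ) :
    harmPow f (k + 1) = harmSeries (harmPow f k) f := rfl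

/-- The power rule. Moving the differentiated factor to the right end needs only
`harmSeries_right_comm`, so associativity and commutativity of * on all of `H1` are never required.
-/
theorem coeff_euler_harmPow_succ {f : (H1 K)⟦X⟧} (hf : ∀ n, ∃ v, coeff n f = toH1 K v) (k n : ℕ) :
    coeff n (euler (harmPow f (k + 1))) =
      ((k + 1 : ℕ) : Coeff K) • coeff n (harmSeries (harmPow f k) (euler f)) := by
  induction k generalizing n with
  | zero =>
    rw [harmPow_succ, coeff_euler_harmSeries]
    have h0 : coeff n (harmSeries (euler (harmPow f 0)) f) = 0 := by
      rw [coeff_harmSeries]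
      refine Finset.sum_eq_zero fun p _ => ?_
      rw [coeff_euler, harmPow, coeff_one]
      split_ifs with h
      · simp [h]
      · simp
    simp [h0]
  | succ k ih =>
    rw [harmPow_succ, coeff_euler_harmSeries]
    have h : coeff n (harmSeries (euler (harmPow f (k + 1))) f) =
        ((k + 1 : ℕ) : Coeff K) • coeff n (harmSeries (harmPow f (k + 1)) (euler f)) := by
      conv_rhs => rw [harmPow_succ, harmSeries_right_comm _ _ _ hf (exists_coeff_euler hf)]
      rw [coeff_harmSeries, coeff_harmSeries, Finset.smul_sum]
      refine Finset.sum_congr rfl fun p _ => ?_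
      rw [ih, map_smul, LinearMap.smul_apply]
    rw [h, Nat.cast_succ (k + 1), add_smul, one_smul]

theorem coeff_harmPow_eq_zero {f : (H1 K)⟦X⟧} (hf : coeff 0 f = 0) {k n : ℕ} (h : n < k) :
    coeff n (harmPow f k) = 0 := by
  induction k generalizing n with
  | zero => omega
  | succ k ih =>
    rw [harmPow, coeff_harmSeries]
    refine Finset.sum_eq_zero fun p hp => ?_
    have hp := Finset.HasAntidiagonal.mem_antidiagonal.mp hp
    rcases Nat.eq_zero_or_pos p.2 with h0 | h0
    · rw [h0, hf, map_zero]
    · rw [ih (by omega), map_zero, LinearMap.zero_apply]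

theorem coeff_expHarm {f : (H1 K)⟦X⟧} (hf : coeff 0 f = 0) {n N : ℕ} (hN : n ≤ N) :
    coeff n (expHarm f) = ∑ k ∈ Finset.range (N + 1),
      (LaurentPolynomial.C (k.factorial : K)⁻¹ : Coeff K) • coeff n (harmPow f k) := by
  rw [expHarm, map_add, formalSum, coeff_mk, Finset.sum_range_succ', add_comm]
  congr 1
  · rw [← Finset.sum_subset (Finset.range_mono hN), Finset.range_eq_Ico,
      Finset.sum_Ico_add' (fun k => (LaurentPolynomial.C (k.factorial : K)⁻¹ : Coeff K) •
        coeff n (harmPow f k)) 0 n 1]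
    · refine Finset.sum_congr (by ext; simp) fun k _ => ?_
      rw [coeff_C_mul, ← Algebra.smul_def]
    · intro k _ hk
      rw [Finset.mem_range, not_lt] at hk
      rw [coeff_harmPow_eq_zero hf (by omega), smul_zero]
  · simp [harmPow]

variable [CharZero K]

/-- The recursion for the coefficients of a harmonic exponential. -/
theorem natCast_smul_coeff_expHarm {f : (H1 K)⟦X⟧} (hf0 : coeff 0 f = 0)
    (hf : ∀ n, ∃ v, coeff n f = toH1 K v) (n : ℕ) :
    (n : Coeff K) • coeff n (expHarm f) = coeff n (harmSeries (expHarm f) (euler f)) := by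
  rw [coeff_expHarm hf0 (Nat.le_succ n), Finset.sum_range_succ', smul_add, Finset.smul_sum,
    coeff_harmSeries]
  have h0 : (n : Coeff K) • (LaurentPolynomial.C ((Nat.factorial 0 : ℕ) : K)⁻¹ : Coeff K) •
      coeff n (harmPow f 0) = 0 := by
    rw [harmPow, coeff_one]
    split_ifs with h
    · simp [h]
    · simp
  rw [h0, add_zero]
  have h1 : ∀ p ∈ Finset.HasAntidiagonal.antidiagonal n,
      harm K (coeff p.1 (expHarm f)) (coeff p.2 (euler f)) =
      ∑ k ∈ Finset.range (n + 1), (LaurentPolynomial.C (k.factorial : K)⁻¹ : Coeff K) •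
        harm K (coeff p.1 (harmPow f k)) (coeff p.2 (euler f)) := by
    intro p hp
    have hp := Finset.HasAntidiagonal.mem_antidiagonal.mp hp
    rw [coeff_expHarm hf0 (show p.1 ≤ n by omega), map_sum, LinearMap.sum_apply]
    simp only [map_smul, LinearMap.smul_apply]
  rw [Finset.sum_congr rfl h1, Finset.sum_comm]
  refine Finset.sum_congr rfl fun k _ => ?_
  rw [← Finset.smul_sum, ← coeff_harmSeries, smul_comm, ← coeff_euler,
    coeff_euler_harmPow_succ hf, smul_smul]
  congr 1
  have hk : ((k + 1 : ℕ) : K) ≠ 0 := by exact_mod_cast Nat.succ_ne_zero k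
  rw [← map_natCast (LaurentPolynomial.C (R := K)), ← map_mul, Nat.factorial_succ, Nat.cast_mul,
    mul_inv_rev, mul_assoc, inv_mul_cancel₀ hk, mul_one]

theorem natCast_smul_injective {n : ℕ} (hn : n ≠ 0) {x y : H1 K}
    (h : (n : Coeff K) • x = (n : Coeff K) • y) : x = y := by
  have hc : (LaurentPolynomial.C ((n : K)⁻¹) : Coeff K) * n = 1 := by
    rw [← map_natCast (LaurentPolynomial.C (R := K)), ← map_mul,
      inv_mul_cancel₀ (Nat.cast_ne_zero.mpr hn), map_one]
  have := congrArg (fun z => (LaurentPolynomial.C ((n : K)⁻¹) : Coeff K) • z) h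
  simpa only [smul_smul, hc, one_smul] using this

/-- A series with constant term `1` satisfying the recursion of a harmonic exponential is equal
to it. -/
theorem eq_expHarm {f y : (H1 K)⟦X⟧} (hf0 : coeff 0 f = 0)
    (hf : ∀ n, ∃ v, coeff n f = toH1 K v) (hy0 : coeff 0 y = 1)
    (hy : ∀ n : ℕ, (n : Coeff K) • coeff n y = coeff n (harmSeries y (euler f))) :
    y = expHarm f := by
  ext n
  induction n using Nat.strong_induction_on with
  | _ n ih =>
    rcases Nat.eq_zero_or_pos n with rfl | hn
    · rw [hy0, coeff_expHarm hf0 le_rfl]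
      simp [harmPow]
    · refine natCast_smul_injective hn.ne' ?_
      rw [hy, natCast_smul_coeff_expHarm hf0 hf, coeff_harmSeries, coeff_harmSeries]
      refine Finset.sum_congr rfl fun p hp => ?_
      have hp := Finset.HasAntidiagonal.mem_antidiagonal.mp hp
      rcases Nat.eq_zero_or_pos p.2 with h0 | h0
      -- The index-zero term of `euler f` vanishes, so the recursion only involves coefficients
      -- already known to agree.
      · rw [h0, coeff_euler]
        simp
      · rw [ih _ (by omega)]

end

/-! ### Geometric series over a noncommutative ring. -/

section

variable {A : Type*} [Ring A]

/-- The geometric series `∑ a ^ m X ^ {N m}`. -/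
def geomSeries (a : A) (N : ℕ) : A⟦X⟧ :=
  PowerSeries.mk fun n => if N ∣ n then a ^ (n / N) else 0

theorem coeff_geomSeries_mul (a : A) {N : ℕ} (hN : N ≠ 0) (n : ℕ) :
    coeff n (geomSeries a N) =
      coeff n (1 : A⟦X⟧) + if N ≤ n then a * coeff (n - N) (geomSeries a N) else 0 := by
  simp only [geomSeries, coeff_mk, coeff_one]
  rcases lt_or_ge n N with h | h
  · rw [if_neg (not_le.mpr h)]
    rcases Nat.eq_zero_or_pos n with rfl | hn
    · simp
    · rw [if_neg (fun hd => absurd (Nat.le_of_dvd hn hd) (by omega)), if_neg (by omega), add_zero]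
  · obtain ⟨m, rfl⟩ := Nat.exists_eq_add_of_le h
    rw [if_pos h, if_neg (show N + m ≠ 0 by omega), zero_add, Nat.add_sub_cancel_left,
      Nat.add_div_left _ (Nat.pos_of_ne_zero hN), pow_succ', mul_ite, mul_zero]
    exact if_congr (Nat.dvd_add_right (dvd_refl N)) rfl rfl

theorem commute_C_geomSeries (a : A) (N : ℕ) : Commute (C a) (geomSeries a N) := by
  ext n
  rw [coeff_C_mul, coeff_mul_C, geomSeries, coeff_mk]
  split_ifs
  · rw [← pow_succ, ← pow_succ']
  · simp

theorem monomial_eq_C_mul_X_pow (a : A) (N : ℕ) : monomial N a = C a * X ^ N := by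
  ext n
  rw [coeff_C_mul, coeff_X_pow, coeff_monomial]
  split_ifs <;> simp

theorem one_sub_monomial_mul_geomSeries (a : A) {N : ℕ} (hN : N ≠ 0) :
    (1 - monomial N a) * geomSeries a N = 1 := by
  rw [sub_mul, one_mul, sub_eq_iff_eq_add]
  ext n
  rw [coeff_geomSeries_mul a hN, map_add, monomial_eq_C_mul_X_pow, mul_assoc, coeff_C_mul,
    coeff_X_pow_mul', mul_ite, mul_zero]

/-- The ring is noncommutative, so this side is checked separately; it follows from the other
because a commutes with its own powers. -/
theorem geomSeries_mul_one_sub_monomial (a : A) {N : ℕ} (hN : N ≠ 0) :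
    geomSeries a N * (1 - monomial N a) = 1 := by
  have h := one_sub_monomial_mul_geomSeries a hN
  rw [sub_mul, one_mul, monomial_eq_C_mul_X_pow, mul_assoc, X_pow_mul, ← mul_assoc,
    (commute_C_geomSeries a N).eq] at h
  rw [mul_sub, mul_one, monomial_eq_C_mul_X_pow, ← mul_assoc, h]

theorem isUnit_one_sub_monomial (a : A) {N : ℕ} (hN : N ≠ 0) :
    IsUnit (1 - monomial N a : A⟦X⟧) :=
  ⟨⟨_, _, one_sub_monomial_mul_geomSeries a hN, geomSeries_mul_one_sub_monomial a hN⟩, rfl⟩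

theorem inverse_one_sub_monomial (a : A) {N : ℕ} (hN : N ≠ 0) :
    Ring.inverse (1 - monomial N a : A⟦X⟧) = geomSeries a N :=
  Ring.inverse_unit ⟨_, _, one_sub_monomial_mul_geomSeries a hN,
    geomSeries_mul_one_sub_monomial a hN⟩

end

/-! ### 1/(1 - vX^N) as a harmonic exponential, and membership in `H0`. -/

section

variable {K : Type*} [Field K] [CharZero K]

/-- `1 / (1 - v X ^ N)` is the harmonic exponential of the logarithm of `1 + v X ^ N` for the
product `∘`. -/
theorem geomSeries_eq_expHarm (v : Z K) {N : ℕ} (hN : N ≠ 0) (f : (H1 K)⟦X⟧)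
    (hf0 : ∀ n, ¬ N ∣ n → coeff n f = 0) (hf1 : coeff 0 f = 0)
    (hf : ∀ m, coeff (N * (m + 1)) f =
      (LaurentPolynomial.C ((-1) ^ m / (m + 1 : K)) : Coeff K) • toH1 K (circPow K v (m + 1))) :
    geomSeries (toH1 K v) N = expHarm f := by
  refine eq_expHarm hf1 (fun n => ?_) (by simp [geomSeries]) fun n => ?_
  · by_cases h : N ∣ n
    · obtain ⟨m, rfl⟩ := h
      rcases m with _ | m
      · exact ⟨0, by simpa using hf1⟩
      · exact ⟨_, by rw [hf, ← map_smul]⟩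
    · exact ⟨0, by rw [hf0 n h, map_zero]⟩
  · rw [coeff_harmSeries]
    by_cases h : N ∣ n
    · obtain ⟨m, rfl⟩ := h
      rcases m with _ | m
      · simp [coeff_euler]
      -- Only pairs whose second exponent is a positive multiple of N contribute: `euler` kills the
      -- constant term, and f is supported on multiples of N.
      · have hz : ∀ p ∈ Finset.HasAntidiagonal.antidiagonal (N * (m + 1)),
            p ∉ (Finset.range (m + 1)).image (fun j => (N * (m - j), N * (j + 1))) →
            harm K (coeff p.1 (geomSeries (toH1 K v) N)) (coeff p.2 (euler f)) = 0 := by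
          rintro ⟨a, b⟩ hp hp'
          have hp : a + b = N * (m + 1) := Finset.HasAntidiagonal.mem_antidiagonal.mp hp
          by_cases hb : N ∣ b
          · obtain ⟨j, rfl⟩ := hb
            rcases j with _ | j
            · simp [coeff_euler]
            · exfalso
              apply hp'
              rw [Finset.mem_image]
              have hj : j + 1 ≤ m + 1 := by
                refine Nat.le_of_mul_le_mul_left ?_ (Nat.pos_of_ne_zero hN)
                exact hp ▸ Nat.le_add_left _ _
              refine ⟨j, Finset.mem_range.mpr (by omega), ?_⟩
              rw [Prod.mk.injEq]
              refine ⟨?_, rfl⟩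
              have : N * (m + 1) = N * (m - j) + N * (j + 1) := by
                rw [← mul_add]; congr 1; omega
              exact (Nat.add_right_cancel (hp.trans this)).symm
          · rw [coeff_euler, hf0 b hb, smul_zero, map_zero]
        rw [← Finset.sum_subset ?_ hz, Finset.sum_image]
        -- The exponent N(j + 1) brought down by `euler` cancels the denominator j + 1 of the
        -- logarithm, leaving N(-1)^j as in `sum_harm_pow_circPow`.
        · have hterm : ∀ j ∈ Finset.range (m + 1),
              harm K (coeff (N * (m - j)) (geomSeries (toH1 K v) N))
                (coeff (N * (j + 1)) (euler f)) =
              (N : Coeff K) • ((-1 : Coeff K) ^ j •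
                harm K (toH1 K v ^ (m - j)) (toH1 K (circPow K v (j + 1)))) := by
            intro j _
            have hj : (j + 1 : K) ≠ 0 := Nat.cast_add_one_ne_zero j
            rw [coeff_euler, hf, geomSeries, coeff_mk, if_pos (dvd_mul_right _ _),
              Nat.mul_div_cancel_left _ (Nat.pos_of_ne_zero hN), map_smul, map_smul, smul_smul,
              smul_smul]
            congr 1
            rw [show (-1 : Coeff K) = LaurentPolynomial.C (-1) by simp,
              ← map_natCast (LaurentPolynomial.C (R := K)),
              ← map_natCast (LaurentPolynomial.C (R := K)), ← map_pow, ← map_mul, ← map_mul]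
            congr 1
            push_cast
            field_simp
          rw [Finset.sum_congr rfl hterm, ← Finset.smul_sum, sum_harm_pow_circPow, smul_smul,
            geomSeries, coeff_mk, if_pos (dvd_mul_right _ _),
            Nat.mul_div_cancel_left _ (Nat.pos_of_ne_zero hN)]
          push_cast
          rfl
        · intro i _ j _ hij
          have := (Prod.mk.injEq _ _ _ _ ▸ hij).2
          have := Nat.eq_of_mul_eq_mul_left (Nat.pos_of_ne_zero hN) this
          omega
        · intro p hp
          obtain ⟨j, hj, rfl⟩ := Finset.mem_image.mp hp
          rw [Finset.mem_range] at hj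
          rw [Finset.HasAntidiagonal.mem_antidiagonal]
          change N * (m - j) + N * (j + 1) = N * (m + 1)
          rw [← mul_add]
          congr 1
          omega
    · rw [geomSeries, coeff_mk, if_neg h, smul_zero]
      refine (Finset.sum_eq_zero fun p hp => ?_).symm
      have hp : p.1 + p.2 = n := Finset.HasAntidiagonal.mem_antidiagonal.mp hp
      by_cases hb : N ∣ p.2
      · rw [coeff_mk, if_neg (fun ha => h (hp ▸ dvd_add ha hb)), map_zero, LinearMap.zero_apply]
      · rw [coeff_euler, hf0 _ hb, smul_zero, map_zero]

omit [CharZero K] in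
theorem mul_toH1_g_mem_H0 (x : H1 K) (k : ℕ+) : x * toH1 K (g K k) ∈ H0 K := by
  have h : ∀ l, word K l * toH1 K (g K k) ∈ H0 K := fun l =>
    Submodule.subset_span (Or.inr ⟨l, k, by simp [word, toH1_single, g]⟩)
  have hx : x ∈ Submodule.span (Coeff K) (Set.range
      (FreeAlgebra.basisFreeMonoid (Coeff K) Letter)) := by
    rw [Module.Basis.span_eq]; trivial
  induction hx using Submodule.span_induction with
  | mem x hx =>
    obtain ⟨w, rfl⟩ := hx
    rw [basis_eq_word]
    exact h _
  | zero => rw [zero_mul]; exact zero_mem _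
  | add x y _ _ hx hy => rw [add_mul]; exact add_mem hx hy
  | smul c x _ hx => rw [smul_mul_assoc]; exact Submodule.smul_mem _ _ hx

omit [CharZero K] in
-- A positive power of v ends in a factor v, which is a combination of the g_k, so every word in it
-- ends in some g_k; the zeroth power is 1.
theorem coeff_geomSeries_mem_H0 {v : Z K}
    (hv : v ∈ Submodule.span (Coeff K) (Set.range (g K))) (N n : ℕ) :
    coeff n (geomSeries (toH1 K v) N) ∈ H0 K := by
  have hx (x : H1 K) : x * toH1 K v ∈ H0 K := by
    induction hv using Submodule.span_induction with
    | mem v hv =>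
      obtain ⟨k, rfl⟩ := hv
      exact mul_toH1_g_mem_H0 x k
    | zero => rw [map_zero, mul_zero]; exact zero_mem _
    | add v w _ _ hv hw => rw [map_add, mul_add]; exact add_mem hv hw
    | smul c v _ hv => rw [map_smul, mul_smul_comm]; exact Submodule.smul_mem _ _ hv
  rw [geomSeries, coeff_mk]
  split_ifs
  · rcases n / N with _ | m
    · rw [pow_zero]
      exact Submodule.subset_span (Or.inl rfl)
    · rw [pow_succ]
      exact hx _
  · exact zero_mem _

end

/-! ### The polynomial model of the span of the g_k. -/

section

variable (K : Type*) [Field K]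

/-- The image `ħ ^ {-j} g_j` of the monomial `s ^ j` in `𝔷`, for `j ≥ 1`. -/
def scaledG : ℕ → Z K
  | 0 => 0
  | j + 1 => ħ K (-((j : ℤ) + 1)) • g K j.succPNat

/-- The linear map `s ^ j ↦ ħ ^ {-j} g_j` from polynomials to `𝔷`, which annihilates constants. -/
def ofPoly : Polynomial K →ₗ[K] Z K := (Polynomial.basisMonomials K).constr K (scaledG K)

theorem ofPoly_C_mul (a : K) (p : Polynomial K) :
    ofPoly K (Polynomial.C a * p) = (LaurentPolynomial.C a : Coeff K) • ofPoly K p := by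
  rw [← Polynomial.smul_eq_C_mul, map_smul]
  exact (algebraMap_smul (Coeff K) a (ofPoly K p)).symm

theorem ofPoly_X_pow (j : ℕ) : ofPoly K (Polynomial.X ^ j) = scaledG K j := by
  have := (Polynomial.basisMonomials K).constr_basis K (scaledG K) j
  rw [Polynomial.coe_basisMonomials] at this
  rwa [Polynomial.X_pow_eq_monomial]

theorem circ_scaledG (i j : ℕ) :
    circ K (scaledG K (i + 1)) (scaledG K (j + 1)) = scaledG K (i + 1 + (j + 1)) := by
  have h : i.succPNat + j.succPNat = (i + 1 + j).succPNat := by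
    rw [← PNat.coe_inj]; simp; ring
  rw [show i + 1 + (j + 1) = (i + 1 + j) + 1 by ring]
  simp only [scaledG, map_smul, LinearMap.smul_apply, g, circ_single_single, letterCirc, h,
    smul_smul, ← LaurentPolynomial.T_add]
  congr 2
  push_cast
  ring

/-- The factors X cannot be dropped: `ofPoly` annihilates constants, so it is multiplicative only on
polynomials without constant term. -/
theorem circ_ofPoly (p q : Polynomial K) :
    circ K (ofPoly K (Polynomial.X * p)) (ofPoly K (Polynomial.X * q)) =
      ofPoly K (Polynomial.X * p * (Polynomial.X * q)) := by
  induction p using Polynomial.induction_on' with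
  | add p p' hp hp' => simp only [mul_add, add_mul, map_add, LinearMap.add_apply, hp, hp']
  | monomial i a =>
    induction q using Polynomial.induction_on' with
    | add q q' hq hq' => simp only [mul_add, map_add, hq, hq']
    | monomial j b =>
      have h (i : ℕ) (a : K) : Polynomial.X * (Polynomial.monomial i a) =
          Polynomial.C a * Polynomial.X ^ (i + 1) := by
        rw [← Polynomial.C_mul_X_pow_eq_monomial]; ring
      rw [h, h, show Polynomial.C a * Polynomial.X ^ (i + 1) *
          (Polynomial.C b * Polynomial.X ^ (j + 1)) =
        Polynomial.C a * (Polynomial.C b * Polynomial.X ^ (i + 1 + (j + 1))) by ring]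
      simp only [ofPoly_C_mul, ofPoly_X_pow, map_smul, LinearMap.smul_apply, circ_scaledG]
      rw [smul_comm]

theorem circPow_ofPoly (p : Polynomial K) (n : ℕ) :
    circPow K (ofPoly K (Polynomial.X * p)) (n + 1) = ofPoly K ((Polynomial.X * p) ^ (n + 1)) := by
  induction n with
  | zero => simp [circPow]
  | succ n ih =>
    rw [circPow_succ _ n.succ_ne_zero, ih, pow_succ _ n, ← mul_assoc, mul_comm _ Polynomial.X,
      mul_assoc, circ_ofPoly]
    congr 1
    ring

theorem circPow_smul (c : Coeff K) (v : Z K) (n : ℕ) :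
    circPow K (c • v) (n + 1) = c ^ (n + 1) • circPow K v (n + 1) := by
  induction n with
  | zero => simp [circPow]
  | succ n ih =>
    rw [circPow_succ _ n.succ_ne_zero, ih, circPow_succ v n.succ_ne_zero, map_smul, map_smul,
      LinearMap.smul_apply, smul_smul, ← pow_succ']

theorem e_two : e K 2 = ħ K 2 • ofPoly K (Polynomial.X + Polynomial.X ^ 2) := by
  have h : ofPoly K Polynomial.X = scaledG K 1 := by
    rw [← ofPoly_X_pow, pow_one]
  rw [map_add, h, ofPoly_X_pow]
  simp only [e, scaledG, smul_add, smul_smul, ← LaurentPolynomial.T_add]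
  rw [add_comm]
  congr 1
  simp

theorem circPow_e_two (L : ℕ) (hL : 1 ≤ L) :
    ((-1) ^ L * ħ K (-2 * L)) • circPow K (e K 2) L =
      ofPoly K ((-(Polynomial.X + Polynomial.X ^ 2)) ^ L) := by
  obtain ⟨n, rfl⟩ : ∃ n, L = n + 1 := ⟨L - 1, by omega⟩
  have hX : (Polynomial.X + Polynomial.X ^ 2 : Polynomial K) =
      Polynomial.X * (1 + Polynomial.X) := by ring
  have hC : ((-1) ^ (n + 1) : Polynomial K) = Polynomial.C ((-1) ^ (n + 1)) := by simp
  rw [e_two, circPow_smul, hX, circPow_ofPoly, smul_smul, LaurentPolynomial.T_pow, mul_assoc,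
    ← LaurentPolynomial.T_add, neg_pow (Polynomial.X * (1 + Polynomial.X) : Polynomial K), hC, ofPoly_C_mul]
  congr 1
  rw [show (-2 * ((n + 1 : ℕ) : ℤ) + ((n + 1 : ℕ) : ℤ) * 2) = 0 by ring]
  simp

theorem ofPoly_stirlingSum (k : ℕ) :
    ofPoly K (stirlingSum Polynomial.X k) = ħ K (-(k : ℤ)) • phi K k := by
  rw [stirlingSum, phi, map_sum, Finset.smul_sum]
  refine Finset.sum_congr rfl fun i _ => ?_
  rw [← Polynomial.C_eq_natCast, ofPoly_C_mul, ofPoly_X_pow, scaledG, smul_smul, smul_smul,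
    map_natCast, mul_left_comm, ← LaurentPolynomial.T_add]
  congr 3
  ring

theorem ofPoly_mem_span (p : Polynomial K) :
    ofPoly K p ∈ Submodule.span (Coeff K) (Set.range (g K)) := by
  induction p using Polynomial.induction_on' with
  | add p q hp hq => rw [map_add]; exact add_mem hp hq
  | monomial i a =>
    rw [← Polynomial.C_mul_X_pow_eq_monomial, ofPoly_C_mul, ofPoly_X_pow]
    refine Submodule.smul_mem _ _ ?_
    cases i with
    | zero => exact zero_mem _
    | succ i => exact Submodule.smul_mem _ _ (Submodule.subset_span ⟨_, rfl⟩)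

variable {K}

theorem two_mul_eq_smul (x : H1 K) : 2 * x = (LaurentPolynomial.C 2 : Coeff K) • x := by
  rw [Algebra.smul_def, map_ofNat, map_ofNat]

theorem coeff_two_mul_formalSum_scalarSeries (s : ℕ → K⟦X⟧) (w : ℕ → H1 K) (n : ℕ) :
    coeff n (2 * formalSum fun k => scalarSeries (s k) (w k)) =
      ∑ k ∈ Finset.Icc 1 n, (LaurentPolynomial.C (2 * coeff n (s k)) : Coeff K) • w k := by
  rw [show (2 : (H1 K)⟦X⟧) = C 2 from (map_ofNat C 2).symm, coeff_C_mul, two_mul_eq_smul,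
    formalSum, coeff_mk, Finset.smul_sum]
  refine Finset.sum_congr rfl fun k _ => ?_
  rw [scalarSeries, coeff_mk, smul_smul, map_mul]

variable [CharZero K]

/-- The logarithm of `1 + (-1)^{L+1} ħ^{-2L} e₂^{∘L} X^{2L}` as a combination of the `φ_{2k}`. -/
theorem coeff_log_eq (L : ℕ) (c : ℕ → K) (n : ℕ) :
    coeff n (2 * formalSum fun k => scalarSeries
      (C ((-1) ^ (k - 1) / ((2 * k).factorial : K)) *
        ∑ m ∈ Finset.Icc 1 L, twoArcsinHalf (c m) ^ (2 * k))
      (ħ K (-2 * k) • toH1 K (phi K (2 * k)))) =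
    toH1 K (ofPoly K (Polynomial.C (∑ m ∈ Finset.Icc 1 L, c m ^ n) *
      coeff n (logOneAddSq (Polynomial.X + Polynomial.X ^ 2 : Polynomial K)))) := by
  rw [coeff_two_mul_formalSum_scalarSeries, map_sum, Finset.sum_mul]
  have h (m : ℕ) := sum_coeff_twoArcsinHalf_mul_stirlingSum (R := Polynomial K) (c m)
    Polynomial.X n
  simp only [Polynomial.algebraMap_eq] at h
  simp only [← h]
  rw [Finset.sum_comm, map_sum, map_sum]
  refine Finset.sum_congr rfl fun k _ => ?_
  rw [← Finset.sum_mul, ← map_sum, ofPoly_C_mul, ofPoly_stirlingSum, coeff_C_mul, map_sum, map_smul,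
    map_smul, ← Finset.mul_sum, ← Finset.mul_sum]
  push_cast
  rw [neg_mul]

/-- The main identity, for any numbers `c₁, …, c_L` whose squares have the power sums of the `L`-th
roots of unity. -/
theorem geomSeries_eq_expHarm_phi (L : ℕ) (hL : 1 ≤ L) (c : ℕ → K)
    (hc : ∀ M, 1 ≤ M → ∑ m ∈ Finset.Icc 1 L, c m ^ (2 * M) = if L ∣ M then (L : K) else 0) :
    geomSeries (toH1 K (ofPoly K (-(-(Polynomial.X + Polynomial.X ^ 2)) ^ L))) (2 * L) =
      expHarm (2 * formalSum fun k => scalarSeries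
        (C ((-1) ^ (k - 1) / ((2 * k).factorial : K)) *
          ∑ m ∈ Finset.Icc 1 L, twoArcsinHalf (c m) ^ (2 * k))
        (ħ K (-2 * k) • toH1 K (phi K (2 * k)))) := by
  refine geomSeries_eq_expHarm _ (by omega) _ (fun n hn => ?_) ?_ fun m => ?_
  · rw [coeff_log_eq]
    rcases Nat.even_or_odd' n with ⟨M, rfl | rfl⟩
    · rw [hc M (by rcases M with _ | M; · simp at hn
                   · omega), if_neg (fun h => hn (Nat.mul_dvd_mul_left 2 h))]
      simp
    · rw [logOneAddSq, coeff_mk, if_neg (by simp [parity_simps])]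
      simp
  · rw [coeff_log_eq, coeff_zero_eq_constantCoeff_apply (logOneAddSq _),
      constantCoeff_logOneAddSq]
    simp
  · obtain ⟨l, rfl⟩ : ∃ l, L = l + 1 := ⟨L - 1, by omega⟩
    -- The polynomial is displayed as a multiple of X, the form `circPow_ofPoly` applies to.
    have hX : (-(-(Polynomial.X + Polynomial.X ^ 2)) ^ (l + 1) : Polynomial K) =
        Polynomial.X * (((-1) ^ l * (1 + Polynomial.X)) * (Polynomial.X + Polynomial.X ^ 2) ^ l) := by
      rw [neg_pow, pow_succ, pow_succ]; ring
    rw [coeff_log_eq, mul_assoc, hc _ (Nat.mul_pos hL m.succ_pos), if_pos (dvd_mul_right _ _), hX,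
      circPow_ofPoly, ← hX, ← map_smul, ← ofPoly_C_mul]
    congr 2
    -- The index L(m + 1) of the logarithm's coefficient is positive; naming it j + 1 removes the
    -- truncated subtraction in its sign. The power sum L then cancels against L(m + 1), leaving the
    -- denominator m + 1.
    obtain ⟨j, hj⟩ : ∃ j, (l + 1) * (m + 1) = j + 1 := ⟨l * m + l + m, by ring⟩
    rw [logOneAddSq, coeff_mk, if_pos (even_two_mul _),
      Nat.mul_div_cancel_left _ (by norm_num : 0 < 2), hj]
    generalize (Polynomial.X + Polynomial.X ^ 2 : Polynomial K) = u
    have hu : (-(-u) ^ (l + 1)) ^ (m + 1) =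
        Polynomial.C ((-1) ^ (m + 1) * (-1) ^ (j + 1)) * u ^ (j + 1) := by
      rw [neg_pow ((-u) ^ (l + 1)), ← pow_mul, hj, neg_pow u]
      simp only [map_mul, map_pow, map_neg, map_one]
      ring
    rw [hu, ← RingHom.map_rat_algebraMap (Polynomial.C (R := K)), ← mul_assoc, ← map_mul,
      ← mul_assoc, ← map_mul]
    congr 2
    have hj' := congrArg (Nat.cast (R := K)) hj
    have h1 : (l + 1 : K) ≠ 0 := Nat.cast_add_one_ne_zero l
    have h2 : (m + 1 : K) ≠ 0 := Nat.cast_add_one_ne_zero m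
    have h3 : (j + 1 : K) ≠ 0 := Nat.cast_add_one_ne_zero j
    have h4 : ((-1) ^ m * (-1) ^ m : K) = 1 := by rw [← mul_pow]; simp
    simp only [map_div₀, map_pow, map_natCast, map_neg, map_one, add_tsub_cancel_right]
    push_cast at hj' ⊢
    rw [pow_succ (-1 : K) m, pow_succ (-1 : K) j]
    field_simp
    linear_combination hj' - (j + 1) * h4

end

/-! ### The algebraic identities over ℂ and ℚ. -/

theorem one_add_monomial_eq (K : Type*) [Field K] (L : ℕ) (hL : 1 ≤ L) :
    (1 + monomial (2 * L) (((-1) ^ L * ħ K (-2 * L)) • toH1 K (circPow K (e K 2) L)) :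
      (H1 K)⟦X⟧) =
    1 - monomial (2 * L)
      (toH1 K (ofPoly K (-(-(Polynomial.X + Polynomial.X ^ 2)) ^ L))) := by
  rw [← map_smul, circPow_e_two K L hL, map_neg, map_neg, map_neg, sub_neg_eq_add]

/-- The squares of the e^{mπi/L} are the L-th roots of unity, so this is the usual geometric sum. -/
theorem sum_exp_pow (L : ℕ) (hL : 1 ≤ L) (M : ℕ) :
    ∑ m ∈ Finset.Icc 1 L, Complex.exp (m * Real.pi * Complex.I / L) ^ (2 * M) =
      if L ∣ M then (L : ℂ) else 0 := by
  have hζ := Complex.isPrimitiveRoot_exp L (by omega)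
  have h (m : ℕ) : Complex.exp (m * Real.pi * Complex.I / L) ^ (2 * M) =
      (Complex.exp (2 * Real.pi * Complex.I / L) ^ M) ^ m := by
    rw [← Complex.exp_nat_mul, ← Complex.exp_nat_mul, ← Complex.exp_nat_mul]
    congr 1
    push_cast
    ring
  simp_rw [h]
  generalize Complex.exp (2 * Real.pi * Complex.I / L) = ζ at hζ
  split_ifs with hd
  · obtain ⟨j, rfl⟩ := hd
    simp [pow_mul, hζ.pow_eq_one]
  · have h1 : ζ ^ M ≠ 1 := fun h => hd (hζ.dvd_of_pow_eq_one M h)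
    have h2 : (ζ ^ M) ^ L = 1 := by rw [← pow_mul, mul_comm, pow_mul, hζ.pow_eq_one, one_pow]
    have h3 := geom_sum_mul (ζ ^ M) L
    rw [h2, sub_self] at h3
    have h4 := (mul_eq_zero.mp h3).resolve_right (sub_ne_zero.mpr h1)
    have h5 : ∑ m ∈ Finset.Icc 1 L, (ζ ^ M) ^ m = ζ ^ M * ∑ m ∈ Finset.range L, (ζ ^ M) ^ m := by
      rw [Finset.mul_sum, Finset.range_eq_Ico]
      simp_rw [← pow_succ']
      rw [Finset.sum_Ico_add' (fun m => (ζ ^ M) ^ m) 0 L 1]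
      exact Finset.sum_congr (by ext; simp) fun _ _ => rfl
    rw [h5, h4, mul_zero]

theorem inverse_eq_expHarm_complex (L : ℕ) (hL : 1 ≤ L) :
    IsUnit (1 + monomial (2 * L)
        (((-1) ^ L * ħ ℂ (-2 * L)) • toH1 ℂ (circPow ℂ (e ℂ 2) L)) : (H1 ℂ)⟦X⟧) ∧
      Ring.inverse (1 + monomial (2 * L)
        (((-1) ^ L * ħ ℂ (-2 * L)) • toH1 ℂ (circPow ℂ (e ℂ 2) L)) : (H1 ℂ)⟦X⟧) =
        expHarm (2 * formalSum fun k =>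
          scalarSeries
            (C ((-1) ^ (k - 1) / ((2 * k).factorial : ℂ)) *
              ∑ m ∈ Finset.Icc 1 L,
                twoArcsinHalf (Complex.exp (m * Real.pi * Complex.I / L)) ^ (2 * k))
            (ħ ℂ (-2 * k) • toH1 ℂ (phi ℂ (2 * k)))) ∧
      ∀ n, coeff n (Ring.inverse (1 + monomial (2 * L)
        (((-1) ^ L * ħ ℂ (-2 * L)) • toH1 ℂ (circPow ℂ (e ℂ 2) L)) : (H1 ℂ)⟦X⟧)) ∈ H0 ℂ := by
  have h2L : 2 * L ≠ 0 := by omega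
  rw [one_add_monomial_eq ℂ L hL, inverse_one_sub_monomial _ h2L]
  exact ⟨isUnit_one_sub_monomial _ h2L,
    geomSeries_eq_expHarm_phi L hL (fun m => Complex.exp (m * Real.pi * Complex.I / L))
      fun M _ => sum_exp_pow L hL M,
    coeff_geomSeries_mem_H0 (ofPoly_mem_span ℂ _) _⟩

/-- The case L = 1. Only the square of c₁ is constrained, so c₁ = 1 may replace e^{πi} = -1 and no
complex numbers enter the statement. -/
theorem inverse_eq_expHarm_rat :
    IsUnit (1 - monomial 2 (ħ ℚ (-2) • toH1 ℚ (e ℚ 2)) : (H1 ℚ)⟦X⟧) ∧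
      Ring.inverse (1 - monomial 2 (ħ ℚ (-2) • toH1 ℚ (e ℚ 2)) : (H1 ℚ)⟦X⟧) =
        expHarm (2 * formalSum fun k =>
          scalarSeries
            (C ((-1) ^ (k - 1) / ((2 * k).factorial : ℚ)) * twoArcsinHalf 1 ^ (2 * k))
            (ħ ℚ (-2 * k) • toH1 ℚ (phi ℚ (2 * k)))) ∧
      ∀ n, coeff n (Ring.inverse
        (1 - monomial 2 (ħ ℚ (-2) • toH1 ℚ (e ℚ 2)) : (H1 ℚ)⟦X⟧)) ∈ H0 ℚ := by
  have he : ħ ℚ (-2) • toH1 ℚ (e ℚ 2) =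
      toH1 ℚ (ofPoly ℚ (-(-(Polynomial.X + Polynomial.X ^ 2)) ^ 1)) := by
    rw [pow_one, neg_neg, e_two, map_smul, smul_smul, ← LaurentPolynomial.T_add]
    simp
  have h := geomSeries_eq_expHarm_phi (K := ℚ) 1 le_rfl (fun _ => 1) (by simp)
  simp only [Finset.Icc_self, Finset.sum_singleton, mul_one] at h
  rw [he, inverse_one_sub_monomial _ two_ne_zero]
  exact ⟨isUnit_one_sub_monomial _ two_ne_zero, h,
    coeff_geomSeries_mem_H0 (ofPoly_mem_span ℚ _) _⟩

/-! ### MacMahon's series as limits of finite products. -/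

/-- A series with constant term 1 is determined by its logarithmic derivative: T exp(-F) has
derivative zero. -/
theorem eq_exp_subst {F T : ℝ⟦X⟧} (hF : constantCoeff F = 0) (hT : constantCoeff T = 1)
    (h : d⁄dX ℝ T = d⁄dX ℝ F * T) : T = (PowerSeries.exp ℝ).subst F := by
  have hF' : constantCoeff (-F) = 0 := by simp [hF]
  have h1 : T * (PowerSeries.exp ℝ).subst (-F) = 1 := by
    refine derivative.ext ?_ ?_
    · rw [Derivation.leibniz, derivative_exp_subst hF', h, map_neg, derivative_one, smul_eq_mul,
        smul_eq_mul]
      ring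
    · simp [constantCoeff_exp_subst hF', hT]
  calc T = T * ((PowerSeries.exp ℝ).subst F * (PowerSeries.exp ℝ).subst (-F)) := by
        rw [exp_subst_mul_exp_subst_neg hF, mul_one]
    _ = (T * (PowerSeries.exp ℝ).subst (-F)) * (PowerSeries.exp ℝ).subst F := by ring
    _ = _ := by rw [h1, one_mul]

theorem derivative_prod_one_add (x : ℕ → ℝ) (M : ℕ) :
    d⁄dX ℝ (∏ n ∈ Finset.range M, (1 + C (x n) * X ^ 2)) =
      d⁄dX ℝ (∑ n ∈ Finset.range M, logOneAddSq (x n)) *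
        ∏ n ∈ Finset.range M, (1 + C (x n) * X ^ 2) := by
  induction M with
  | zero => simp
  | succ M ih =>
    have h := derivative_logOneAddSq (x M)
    rw [Finset.prod_range_succ, Finset.sum_range_succ, Derivation.leibniz, ih, map_add, map_add,
      derivative_one, Derivation.leibniz, derivative_pow, derivative_X, derivative_C]
    simp only [smul_eq_mul]
    push_cast
    linear_combination (-∏ n ∈ Finset.range M, (1 + C (x n) * X ^ 2)) * h

/-- The cardinality condition is kept as an `if` over all subsets, so that the coefficient is a
partial sum of a family indexed by all finite sets. -/
theorem coeff_prod_one_add (x : ℕ → ℝ) (M r : ℕ) :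
    coeff (2 * r) (∏ n ∈ Finset.range M, (1 + C (x n) * X ^ 2)) =
      ∑ s ∈ (Finset.range M).powerset, if s.card = r then ∏ i ∈ s, x i else 0 := by
  rw [Finset.prod_one_add, map_sum]
  refine Finset.sum_congr rfl fun s _ => ?_
  rw [Finset.prod_mul_distrib, Finset.prod_const, ← map_prod, ← pow_mul, coeff_C_mul_X_pow]
  exact if_congr (by omega) rfl rfl

theorem coeff_prod_one_add_of_odd (x : ℕ → ℝ) (M r : ℕ) :
    coeff (2 * r + 1) (∏ n ∈ Finset.range M, (1 + C (x n) * X ^ 2)) = 0 := by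
  rw [Finset.prod_one_add, map_sum]
  refine Finset.sum_eq_zero fun s _ => ?_
  rw [Finset.prod_mul_distrib, Finset.prod_const, ← map_prod, ← pow_mul, coeff_C_mul_X_pow,
    if_neg (by omega)]

/-- Finite subsets of `ℕ` of cardinality `r`, as strictly increasing sequences of positive
integers. -/
def finsetEquivStrictMono (r : ℕ) :
    {s : Finset ℕ // s.card = r} ≃ {m : Fin r → ℕ // StrictMono m ∧ ∀ a, 0 < m a} :=
  Equiv.ofBijective (fun s => ⟨fun a => s.1.orderEmbOfFin s.2 a + 1,
      fun _ _ h => Nat.succ_lt_succ ((s.1.orderEmbOfFin s.2).strictMono h), fun _ => Nat.succ_pos _⟩)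
    ⟨fun s t h => by
      have h1 : (fun a => s.1.orderEmbOfFin s.2 a) = fun a => t.1.orderEmbOfFin t.2 a := by
        funext a
        exact Nat.succ_injective (congrFun (congrArg Subtype.val h) a)
      have h2 := Finset.range_orderEmbOfFin s.1 s.2
      have h3 := Finset.range_orderEmbOfFin t.1 t.2
      apply Subtype.ext
      rw [← Finset.coe_inj, ← h2, ← h3]
      exact congrArg Set.range h1,
    fun m => by
      have hm : StrictMono fun a => m.1 a - 1 := fun a b h => by
        have h1 := m.2.1 h
        have h2 := m.2.2 a
        change m.1 a - 1 < m.1 b - 1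
        omega
      have hc : (Finset.univ.image fun a => m.1 a - 1).card = r := by
        rw [Finset.card_image_of_injective _ hm.injective, Finset.card_fin]
      refine ⟨⟨_, hc⟩, Subtype.ext (funext fun a => ?_)⟩
      have := Finset.orderEmbOfFin_unique hc
        (fun a => Finset.mem_image_of_mem _ (Finset.mem_univ a)) hm
      have h1 := congrFun this a
      have h2 := m.2.2 a
      change Finset.orderEmbOfFin _ hc a + 1 = m.1 a
      rw [← h1]
      omega⟩

/-- The general term `q ^ {n + 1} / (1 - q ^ {n + 1}) ^ 2` of `A₁(q)`. -/
def macMahonBase (q : ℝ) (n : ℕ) : ℝ := q ^ (n + 1) / (1 - q ^ (n + 1)) ^ 2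

theorem macMahonTerm_finsetEquivStrictMono (q : ℝ) (r : ℕ) (s : {s : Finset ℕ // s.card = r}) :
    macMahonTerm q r (finsetEquivStrictMono r s) = ∏ i ∈ s.1, macMahonBase q i := by
  have h := Finset.map_orderEmbOfFin_univ s.1 s.2
  conv_rhs => rw [← h, Finset.prod_map]
  rfl

theorem one_sub_pow_pos {q : ℝ} (h0 : 0 < q) (h1 : q < 1) (n : ℕ) : 0 < 1 - q ^ (n + 1) :=
  sub_pos.mpr (pow_lt_one₀ h0.le h1 n.succ_ne_zero)

theorem macMahonBase_nonneg {q : ℝ} (h0 : 0 < q) (n : ℕ) : 0 ≤ macMahonBase q n := by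
  unfold macMahonBase; positivity

theorem summable_macMahonBase {q : ℝ} (h0 : 0 < q) (h1 : q < 1) : Summable (macMahonBase q) := by
  refine Summable.of_nonneg_of_le (macMahonBase_nonneg h0) (fun n => ?_)
    ((summable_geometric_of_lt_one h0.le h1).mul_left (1 / (1 - q) ^ 2))
  have h2 : 0 < 1 - q := sub_pos.mpr h1
  have h3 : q ^ (n + 1) ≤ q := pow_le_of_le_one h0.le h1.le n.succ_ne_zero
  have h4 : q ^ (n + 1) ≤ q ^ n := pow_le_pow_of_le_one h0.le h1.le n.le_succ
  rw [macMahonBase, one_div_mul_eq_div]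
  gcongr

/-- For a nonnegative summable family, the products over all finite index sets are summable; A_r(q)
is the part indexed by sets of size r. -/
theorem hasSum_macMahonA {q : ℝ} (h0 : 0 < q) (h1 : q < 1) (r : ℕ) :
    Summable (macMahonTerm q r) ∧
      HasSum (fun s : Finset ℕ => if s.card = r then ∏ i ∈ s, macMahonBase q i else 0)
        (macMahonA q r) := by
  have hs : Summable fun s : Finset ℕ => ∏ i ∈ s, macMahonBase q i :=
    summable_finsetProd_of_summable_nonneg (macMahonBase_nonneg h0) (summable_macMahonBase h0 h1)
  have hs' : Summable fun s : {s : Finset ℕ // s.card = r} => ∏ i ∈ s.1, macMahonBase q i :=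
    hs.comp_injective Subtype.val_injective
  have he : (macMahonTerm q r ∘ finsetEquivStrictMono r) =
      fun s => ∏ i ∈ s.1, macMahonBase q i :=
    funext fun s => macMahonTerm_finsetEquivStrictMono q r s
  have hsum : Summable (macMahonTerm q r) := by
    rw [← (finsetEquivStrictMono r).summable_iff, he]
    exact hs'
  refine ⟨hsum, ?_⟩
  have h2 := hsum.hasSum
  rw [← (finsetEquivStrictMono r).hasSum_iff, he] at h2
  have h3 := hasSum_subtype_iff_indicator (s := {s : Finset ℕ | s.card = r})
    (f := fun s => ∏ i ∈ s, macMahonBase q i) |>.mp h2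
  convert h3 using 1
  · ext s
    simp [Set.indicator_apply]
  · rfl

theorem tendsto_coeff_prod {q : ℝ} (h0 : 0 < q) (h1 : q < 1) (r : ℕ) :
    Filter.Tendsto (fun M => coeff (2 * r)
      (∏ n ∈ Finset.range M, (1 + C (macMahonBase q n) * X ^ 2))) Filter.atTop
      (nhds (macMahonA q r)) := by
  simp only [coeff_prod_one_add]
  refine (hasSum_macMahonA h0 h1 r).2.comp (Filter.tendsto_atTop_finset_of_monotone ?_ ?_)
  · exact fun M N h => Finset.powerset_mono.mpr (Finset.range_mono h)
  · intro s
    obtain ⟨M, hM⟩ := s.exists_nat_subset_range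
    exact ⟨M, Finset.mem_powerset.mpr hM⟩

/-! ### Eisenstein series as sums of Stirling sums. -/

/-- `∑_{d ≥ 1} d ^ k y ^ d` is a Stirling sum in `y / (1 - y)`. -/
theorem hasSum_pow_mul_geometric {y : ℝ} (h0 : 0 ≤ y) (h1 : y < 1) (k : ℕ) :
    HasSum (fun d : ℕ => ((d : ℝ) + 1) ^ k * y ^ (d + 1)) (stirlingSum (y / (1 - y)) (k + 1)) := by
  have hy : ‖y‖ < 1 := by rwa [Real.norm_of_nonneg h0]
  have hsum (k : ℕ) : Summable fun d : ℕ => ((d : ℝ) + 1) ^ k * y ^ (d + 1) := by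
    have h : Summable fun d : ℕ => (d : ℝ) ^ k * y ^ d :=
      summable_pow_mul_geometric_of_norm_lt_one k hy
    refine ((summable_nat_add_iff 1).mpr h).congr fun d => ?_
    push_cast
    rfl
  set b : ℕ → ℝ := fun k => ∑' d : ℕ, ((d : ℝ) + 1) ^ k * y ^ (d + 1) with hb
  -- Splitting off the first term and expanding ((d + 1) + 1)^n by the binomial theorem gives the
  -- recursion of the Stirling sums at y/(1 - y). Its top term can be solved for because 1 - y ≠ 0.
  have hrec (n : ℕ) : b n = y * (1 + ∑ k ∈ Finset.range (n + 1), (n.choose k : ℝ) * b k) := by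
    have hstep : ∀ d : ℕ, ((d + 1 : ℕ) + 1 : ℝ) ^ n * y ^ (d + 1 + 1) =
        y * ∑ k ∈ Finset.range (n + 1), (n.choose k : ℝ) * (((d : ℝ) + 1) ^ k * y ^ (d + 1)) := by
      intro d
      push_cast
      rw [add_pow ((d : ℝ) + 1) 1 n, Finset.sum_mul, Finset.mul_sum]
      refine Finset.sum_congr rfl fun k _ => ?_
      rw [one_pow]; ring
    rw [hb]
    change ∑' d : ℕ, ((d : ℝ) + 1) ^ n * y ^ (d + 1) = _
    rw [(hsum n).tsum_eq_zero_add]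
    simp only [hstep]
    rw [tsum_mul_left, Summable.tsum_finsetSum fun k _ => (hsum k).mul_left _]
    simp only [tsum_mul_left]
    simp
    ring
  have hs (n : ℕ) : b n = stirlingSum (y / (1 - y)) (n + 1) := by
    have h1y : 1 - y ≠ 0 := (sub_pos.mpr h1).ne'
    induction n using Nat.strong_induction_on with
    | _ n ih =>
      have hr := stirlingSum_recursion (y / (1 - y)) n
      have hb' := hrec n
      rw [Finset.sum_range_succ, Nat.choose_self] at hr hb'
      rw [Finset.sum_congr rfl fun k hk => by rw [ih k (Finset.mem_range.mp hk)]] at hb'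
      generalize ∑ k ∈ Finset.range n,
        (n.choose k : ℝ) * stirlingSum (y / (1 - y)) (k + 1) = S at hr hb'
      generalize stirlingSum (y / (1 - y)) (n + 1) = B at hr ⊢
      field_simp at hr
      push_cast at hr hb'
      apply mul_left_cancel₀ h1y
      linear_combination hb' - hr
  have := (hsum k).hasSum
  rwa [show ∑' d : ℕ, ((d : ℝ) + 1) ^ k * y ^ (d + 1) = b k from rfl, hs] at this

/-- Comparison with ∑ n^{k+1} q^n, since σ_k(n) ≤ n^{k+1}. -/
theorem summable_eisensteinTerm {q : ℝ} (h0 : 0 < q) (h1 : q < 1) (k : ℕ) :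
    Summable (eisensteinTerm q (k + 1)) := by
  have hq : ‖q‖ < 1 := by rwa [Real.norm_of_nonneg h0.le]
  have h : Summable fun d : ℕ => (d : ℝ) ^ (k + 1) * q ^ d :=
    summable_pow_mul_geometric_of_norm_lt_one (k + 1) hq
  refine Summable.of_nonneg_of_le (fun n => ?_) (fun n => ?_) ((summable_nat_add_iff 1).mpr h)
  · unfold eisensteinTerm; positivity
  · unfold eisensteinTerm
    have := ArithmeticFunction.sigma_le_pow_succ k (n + 1)
    rw [Nat.add_sub_cancel]
    gcongr
    exact_mod_cast this

/-- A Lambert series: each Stirling sum expands as ∑ c^k q^{(n+1)c} over c ≥ 1, and the double sum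
is regrouped by the value of (n + 1)c. -/
theorem hasSum_stirlingSum_eisensteinG {q : ℝ} (h0 : 0 < q) (h1 : q < 1) (k : ℕ) :
    HasSum (fun n : ℕ => stirlingSum (q ^ (n + 1) / (1 - q ^ (n + 1))) (k + 1))
      (eisensteinG q (k + 1)) := by
  have hq : ‖q‖ < 1 := by rwa [Real.norm_of_nonneg h0.le]
  have hin (n : ℕ) : ∑' c : ℕ+, (c : ℝ) ^ k * q ^ ((n + 1) * c : ℕ) =
      stirlingSum (q ^ (n + 1) / (1 - q ^ (n + 1))) (k + 1) := by
    rw [tsum_pnat_eq_tsum_succ (f := fun c : ℕ => (c : ℝ) ^ k * q ^ ((n + 1) * c)),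
      ← (hasSum_pow_mul_geometric (pow_nonneg h0.le (n + 1))
        (pow_lt_one₀ h0.le h1 n.succ_ne_zero) k).tsum_eq]
    refine tsum_congr fun d => ?_
    rw [pow_mul]
    push_cast
    rfl
  have hs : Summable fun d : ℕ+ => ∑' c : ℕ+, (c : ℝ) ^ k * q ^ (d * c : ℕ) :=
    (summable_prod_mul_pow k hq).prod
  have hs' : Summable fun n : ℕ => ∑' c : ℕ+, (c : ℝ) ^ k * q ^ ((n + 1) * c : ℕ) :=
    (summable_pnat_iff_summable_succ
      (f := fun d : ℕ => ∑' c : ℕ+, (c : ℝ) ^ k * q ^ (d * c : ℕ))).mp hs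
  have ht := tsum_prod_pow_eq_tsum_sigma k hq
  rw [tsum_pnat_eq_tsum_succ (f := fun d : ℕ => ∑' c : ℕ+, (c : ℝ) ^ k * q ^ (d * c : ℕ)),
    tsum_pnat_eq_tsum_succ
      (f := fun e : ℕ => (ArithmeticFunction.sigma k e : ℝ) * q ^ e)] at ht
  simp only [hin] at hs' ht
  rw [hs'.hasSum_iff, ht]
  rfl

/-! ### Bachmann's formula by passage to the limit. -/

/-- The exponent in Bachmann's formula. -/
def bachmannLog (q : ℝ) : ℝ⟦X⟧ :=
  2 * formalSum fun k =>
    C ((-1) ^ (k - 1) / ((2 * k).factorial : ℝ) * eisensteinG q (2 * k)) *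
      twoArcsinHalf (1 : ℝ) ^ (2 * k)

theorem coeff_bachmannLog (q : ℝ) (N : ℕ) :
    coeff N (bachmannLog q) = ∑ k ∈ Finset.Icc 1 N,
      2 * ((-1) ^ (k - 1) / ((2 * k).factorial : ℝ) *
        coeff N (twoArcsinHalf (1 : ℝ) ^ (2 * k))) * eisensteinG q (2 * k) := by
  rw [bachmannLog, show (2 : ℝ⟦X⟧) = C 2 from (map_ofNat C 2).symm, coeff_C_mul, formalSum,
    coeff_mk, Finset.mul_sum]
  refine Finset.sum_congr rfl fun k _ => ?_
  rw [coeff_C_mul]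
  ring

theorem tendsto_coeff_sum_logOneAddSq {q : ℝ} (h0 : 0 < q) (h1 : q < 1) (N : ℕ) :
    Filter.Tendsto (fun M => coeff N
      (∑ n ∈ Finset.range M, logOneAddSq (macMahonBase q n))) Filter.atTop
      (nhds (coeff N (bachmannLog q))) := by
  have hlog (n : ℕ) : coeff N (logOneAddSq (macMahonBase q n)) =
      ∑ k ∈ Finset.Icc 1 N, 2 * ((-1) ^ (k - 1) / ((2 * k).factorial : ℝ) *
        coeff N (twoArcsinHalf (1 : ℝ) ^ (2 * k))) *
          stirlingSum (q ^ (n + 1) / (1 - q ^ (n + 1))) (2 * k) := by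
    have h := sum_coeff_twoArcsinHalf_mul_stirlingSum (1 : ℝ)
      (q ^ (n + 1) / (1 - q ^ (n + 1))) N
    simp only [Algebra.algebraMap_self, RingHom.id_apply, one_pow, one_mul] at h
    rw [h]
    -- With s = q^{n+1}/(1 - q^{n+1}), the argument s + s² is q^{n+1}/(1 - q^{n+1})².
    congr 2
    have := (one_sub_pow_pos h0 h1 n).ne'
    rw [macMahonBase]
    field_simp
    ring
  simp only [map_sum, hlog, coeff_bachmannLog]
  simp_rw [Finset.sum_comm (s := Finset.range _), ← Finset.mul_sum]
  refine tendsto_finsetSum _ fun k hk => Filter.Tendsto.const_mul _ ?_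
  obtain ⟨j, hj⟩ : ∃ j, 2 * k = j + 1 :=
    ⟨2 * k - 1, by have := (Finset.mem_Icc.mp hk).1; omega⟩
  rw [hj]
  exact (hasSum_stirlingSum_eisensteinG h0 h1 j).tendsto_sum_nat

theorem coeff_one_add_formalSum_monomial (a : ℕ → ℝ) :
    (∀ r, coeff (2 * (r + 1)) (1 + formalSum fun r => monomial (2 * r) (a r)) = a (r + 1)) ∧
      (∀ r, coeff (2 * r + 1) (1 + formalSum fun r => monomial (2 * r) (a r)) = 0) := by
  constructor <;> intro r
  · rw [map_add, coeff_one, if_neg (by omega), zero_add, formalSum, coeff_mk,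
      Finset.sum_eq_single (r + 1)]
    · rw [coeff_monomial_same]
    · intro k _ hk
      rw [coeff_monomial, if_neg (by omega)]
    · intro h
      exact absurd (Finset.mem_Icc.mpr ⟨by omega, by omega⟩) h
  · rw [map_add, coeff_one, if_neg (by omega), zero_add, formalSum, coeff_mk]
    refine Finset.sum_eq_zero fun k _ => ?_
    rw [coeff_monomial, if_neg (by omega)]

theorem tendsto_coeff_prod_one_add {q : ℝ} (h0 : 0 < q) (h1 : q < 1) (N : ℕ) :
    Filter.Tendsto (fun M => coeff N
      (∏ n ∈ Finset.range M, (1 + C (macMahonBase q n) * X ^ 2))) Filter.atTop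
      (nhds (coeff N (1 + formalSum fun r => monomial (2 * r) (macMahonA q r)))) := by
  have h := coeff_one_add_formalSum_monomial (macMahonA q)
  rcases Nat.even_or_odd' N with ⟨r, rfl | rfl⟩
  · rcases r with _ | r
    · simp [formalSum]
    · rw [h.1]
      exact tendsto_coeff_prod h0 h1 (r + 1)
  · rw [h.2]
    simp only [coeff_prod_one_add_of_odd]
    exact tendsto_const_nhds

/-- The finite products satisfy T' = F' T with F the sum of the logarithms. Each coefficient of this
equation involves finitely many coefficients of T and F, so it survives the coefficientwise limit,
and `eq_exp_subst` concludes. -/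
theorem bachmann_formula {q : ℝ} (h0 : 0 < q) (h1 : q < 1) :
    1 + formalSum (fun r => monomial (2 * r) (macMahonA q r)) =
      (PowerSeries.exp ℝ).subst (bachmannLog q) := by
  refine eq_exp_subst ?_ ?_ ?_
  · rw [← coeff_zero_eq_constantCoeff_apply, coeff_bachmannLog]
    simp
  · rw [← coeff_zero_eq_constantCoeff_apply, map_add, formalSum, coeff_mk]
    simp
  · ext N
    have hT := (tendsto_coeff_prod_one_add h0 h1 (N + 1)).mul_const ((N : ℝ) + 1)
    refine tendsto_nhds_unique (by simpa only [← coeff_derivative] using hT) ?_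
    simp only [derivative_prod_one_add, coeff_mul]
    refine tendsto_finsetSum _ fun p _ => Filter.Tendsto.mul ?_
      (tendsto_coeff_prod_one_add h0 h1 p.2)
    simp only [coeff_derivative]
    exact (tendsto_coeff_sum_logOneAddSq h0 h1 (p.1 + 1)).mul_const _

end HarmonicAlgebra

end

open HarmonicAlgebra PowerSeries in
theorem corollary4p3 :
    -- the identity for every `L ≥ 1`, over `ℂ`, with coefficients in `H0`
    (∀ L : ℕ, 1 ≤ L →
      IsUnit (1 + monomial (2 * L)
        (((-1) ^ L * ħ ℂ (-2 * L)) • toH1 ℂ (circPow ℂ (e ℂ 2) L)) : (H1 ℂ)⟦X⟧) ∧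
      Ring.inverse (1 + monomial (2 * L)
        (((-1) ^ L * ħ ℂ (-2 * L)) • toH1 ℂ (circPow ℂ (e ℂ 2) L)) : (H1 ℂ)⟦X⟧) =
        expHarm (2 * formalSum fun k =>
          scalarSeries
            (C ((-1) ^ (k - 1) / ((2 * k).factorial : ℂ)) *
              ∑ m ∈ Finset.Icc 1 L,
                twoArcsinHalf (Complex.exp (m * Real.pi * Complex.I / L)) ^ (2 * k))
            (ħ ℂ (-2 * k) • toH1 ℂ (phi ℂ (2 * k)))) ∧
      ∀ n, coeff n (Ring.inverse (1 + monomial (2 * L)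
        (((-1) ^ L * ħ ℂ (-2 * L)) • toH1 ℂ (circPow ℂ (e ℂ 2) L)) : (H1 ℂ)⟦X⟧)) ∈ H0 ℂ) ∧
    -- the algebraic form of Bachmann's identity, over `ℚ`, with coefficients in `H0`
    (IsUnit (1 - monomial 2 (ħ ℚ (-2) • toH1 ℚ (e ℚ 2)) : (H1 ℚ)⟦X⟧) ∧
      Ring.inverse (1 - monomial 2 (ħ ℚ (-2) • toH1 ℚ (e ℚ 2)) : (H1 ℚ)⟦X⟧) =
        expHarm (2 * formalSum fun k =>
          scalarSeries
            (C ((-1) ^ (k - 1) / ((2 * k).factorial : ℚ)) * twoArcsinHalf 1 ^ (2 * k))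
            (ħ ℚ (-2 * k) • toH1 ℚ (phi ℚ (2 * k)))) ∧
      ∀ n, coeff n (Ring.inverse
        (1 - monomial 2 (ħ ℚ (-2) • toH1 ℚ (e ℚ 2)) : (H1 ℚ)⟦X⟧)) ∈ H0 ℚ) ∧
    -- Bachmann's formula
    (∀ q : ℝ, 0 < q → q < 1 →
      (∀ r, 1 ≤ r → Summable (macMahonTerm q r)) ∧
      (∀ k, 1 ≤ k → Summable (eisensteinTerm q (2 * k))) ∧
      1 + formalSum (fun r => monomial (2 * r) (macMahonA q r)) =
        (PowerSeries.exp ℝ).subst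
          (2 * formalSum fun k =>
            C ((-1) ^ (k - 1) / ((2 * k).factorial : ℝ) * eisensteinG q (2 * k)) *
              twoArcsinHalf (1 : ℝ) ^ (2 * k))) := by
  refine ⟨inverse_eq_expHarm_complex, inverse_eq_expHarm_rat, fun q h0 h1 => ⟨fun r _ =>
    (hasSum_macMahonA h0 h1 r).1, fun k hk => ?_, bachmann_formula h0 h1⟩⟩
  obtain ⟨j, hj⟩ : ∃ j, 2 * k = j + 1 := ⟨2 * k - 1, by omega⟩
  rw [hj]
  exact summable_eisensteinTerm h0 h1 j
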